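/- **Problems.** In *small-set vertex expansion* (SSVE) one is given a bipartite graph $(U\cup V,E)$ and a rational $0<\alpha\le 1$, and seeks $S\subseteq U$ with $|S|\ge\alpha|U|$ minimizing the number $|\Gamma(S)|$ of neighbours of $S$; write $n=|U|+|V|$ and $m=|E|$. In *$k$-route $s$-$t$ cut* one is given an undirected multigraph with nonnegative rational edge costs, distinct nodes $s,t$ and an integer $k\ge1$, and seeks a minimum-cost edge set $F$ whose deletion leaves at most $k-1$ edge-disjoint $s$-$t$ paths. In D$k$S on $\lambda$-uniform hypergraphs one seeks $k$ nodes containing the maximum number of hyperedges. A $\rho$-approximation is a polynomial-time algorithm that always returns a feasible solution within a factor $\rho$ of the optimum (for D$k$S: of value at least the optimum divided by $\rho$). **Theorem.** There is an absolute constant $c$ such that the following hold. 1. *(Reduction.)* There are polynomial-time computable maps $f$, from SSVE-instances to $k$-route $s$-$t$ cut instances, and $g$, from pairs ($I$, edge set of $f(I)$) to subsets of $U$, and a positive integer $B=B(I)$, such that for every SSVE-instance $I$ with $n$ nodes and $m$ edges: * $f(I)$ has at most $cn^3$ nodes (if $n\ge1$), at most $c(mn^2+n^5)$ edges, and $k\le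 c\,mn^2$ (if $m\ge1$); * for every feasible $S$ for $I$ there is a feasible $F$ for $f(I)$ of cost at most $B\,|\Gamma(S)|$; * for every feasible $F$ for $f(I)$, the set $S=g(I,F)$ is feasible for $I$; if $F$ has cost at most $CB$ for an integer $C\ge0$ then $|\Gamma(S)|\le C$; and in any case $|\Gamma(S)|\le \mathrm{cost}(F)/B+1/n$ (the last term being read as $0$ if $n=0$). In particular, for each integer $C\ge 0$, $I$ has a solution of value at most $C$ if and only if $f(I)$ has a solution of cost at most $CB$. 2. *(SSVE.)* Suppose that $k$-route $s$-$t$ cut has a $\rho(k,m,n)$-approximation, where $m,n$ count the edges and nodes. Let $\sigma(m,n)\ge\rho(k',m',n')$ for all $k'\le c\,mn^2$, $m'\le c(mn^2+n^5)$, $n'\le cn^3$ (for monotone $\rho$ one can take $\sigma(m,n)=\rho(c\,mn^2,c(mn^2+n^5),cn^3)$). If $\sigma$ is integer-valued, then SSVE has a $\sigma(m,n)$-approximation; for real-valued $\sigma$, SSVE has a $(\sigma(m,n)+1/n)$-approximation. 3. *(D$k$S-hardness.)* Suppose that $k$-route $s$-$t$ cut has a $\rho(k,m,n)$-approximation, and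 let $\lambda\ge2$. Let $\sigma(m,n)\ge\rho(k',m',n')$ for all $k'\le c\,\lambda m(m+n)^2$, $m'\le c(\lambda m(m+n)^2+(m+n)^5)$, $n'\le c(m+n)^3$. Then D$k$S on $\lambda$-uniform hypergraphs with $n$ nodes and $m$ hyperedges has a $2\,\sigma(m,n)^\lambda$-approximation. -/

import Mathlib

namespace KRoute

/-! ### A small programming language with a step count -/

/-- The values that programs handle: numbers (thought of as written in binary) and pairs. -/
inductive Data where
  | nat (n : ℕ) : Data
  | pair (a b : Data) : Data

/-- The length of a value; a number counts with its binary length. -/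
def Data.size : Data → ℕ
  | .nat n => 1 + Nat.size n
  | .pair a b => 1 + a.size + b.size

/-- Elementary operations. The arithmetic operations act on a pair of two numbers. -/
inductive Op where
  | id | const (n : ℕ) | fst | snd | isPair | add | sub | mul | div

/-- The result of an elementary operation (the number `0` on arguments of a wrong shape). -/
def Op.apply : Op → Data → Data
  | .id, x => x
  | .const n, _ => .nat n
  | .fst, .pair a _ => a
  | .snd, .pair _ b => b
  | .isPair, .pair _ _ => .nat 1
  | .add, .pair (.nat a) (.nat b) => .nat (a + b)
  | .sub, .pair (.nat a) (.nat b) => .nat (a - b)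
  | .mul, .pair (.nat a) (.nat b) => .nat (a * b)
  | .div, .pair (.nat a) (.nat b) => .nat (a / b)
  | _, _ => .nat 0

/-- Programs: elementary operations, pairing of two results, sequential composition,
conditional, and a while loop (`0` is read as false, every other value as true). -/
inductive Prog where
  | op (o : Op) : Prog
  | pair (p q : Prog) : Prog
  | seq (p q : Prog) : Prog
  | ite (c p q : Prog) : Prog
  | loop (c p : Prog) : Prog

/-- `Eval p x y t`: on input `x` the program `p` halts with output `y`, at cost `t`.
An elementary operation is charged the lengths of its argument and of its result, so
that the cost bounds the length of every value that occurs, and cost agrees with the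
running time on a Turing machine up to a polynomial. -/
inductive Eval : Prog → Data → Data → ℕ → Prop
  | op (o : Op) (x : Data) : Eval (.op o) x (o.apply x) (1 + x.size + (o.apply x).size)
  | pair {p q : Prog} {x y z : Data} {t u : ℕ} :
      Eval p x y t → Eval q x z u → Eval (.pair p q) x (.pair y z) (t + u + 1)
  | seq {p q : Prog} {x y z : Data} {t u : ℕ} :
      Eval p x y t → Eval q y z u → Eval (.seq p q) x z (t + u + 1)
  | ite_true {c p q : Prog} {x b y : Data} {t u : ℕ} :
      Eval c x b t → b ≠ .nat 0 → Eval p x y u → Eval (.ite c p q) x y (t + u + 1)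
  | ite_false {c p q : Prog} {x y : Data} {t u : ℕ} :
      Eval c x (.nat 0) t → Eval q x y u → Eval (.ite c p q) x y (t + u + 1)
  | loop_stop {c p : Prog} {x : Data} {t : ℕ} :
      Eval c x (.nat 0) t → Eval (.loop c p) x x (t + 1)
  | loop_step {c p : Prog} {x b y z : Data} {t u v : ℕ} :
      Eval c x b t → b ≠ .nat 0 → Eval p x y u → Eval (.loop c p) y z v →
        Eval (.loop c p) x z (t + u + v + 1)

/-- Some program computes `out i` from `inp i`, for every `i`, in time polynomial in the
length of `inp i`. -/
def PolyTime {ι : Type*} (inp out : ι → Data) : Prop :=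
  ∃ (p : Prog) (P : Polynomial ℕ), ∀ i, ∃ t, t ≤ P.eval (inp i).size ∧ Eval p (inp i) (out i) t

/-! ### Encodings -/

def encList : List Data → Data
  | [] => .nat 0
  | a :: l => .pair a (encList l)

/-- Unary encoding, used for numbers of vertices. -/
def encUnary (n : ℕ) : Data := encList (List.replicate n (.nat 0))

/-- A rational number as a reduced fraction, in binary. -/
def encRat (q : ℚ≥0) : Data := .pair (.nat q.num) (.nat q.den)

/-- A set as its characteristic vector. -/
def encSet {n : ℕ} (S : Finset (Fin n)) : Data :=
  encList (List.ofFn fun i => if i ∈ S then Data.nat 1 else Data.nat 0)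

/-! ### Small-set vertex expansion -/

/-- A bipartite graph with sides `U = Fin nU`, `V = Fin nV`, and a number `0 < α ≤ 1`. -/
structure SSVE where
  nU : ℕ
  nV : ℕ
  edges : List (Fin nU × Fin nV)
  nodup : edges.Nodup
  α : ℚ≥0
  α_pos : 0 < α
  α_le_one : α ≤ 1

namespace SSVE

/-- Number of nodes. -/
def n (I : SSVE) : ℕ := I.nU + I.nV

/-- Number of edges. -/
def m (I : SSVE) : ℕ := I.edges.length

def enc (I : SSVE) : Data :=
  .pair (encUnary I.nU) (.pair (encUnary I.nV)
    (.pair (encList (I.edges.map fun e => .pair (.nat e.1) (.nat e.2))) (encRat I.α)))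

/-- The set `Γ(S)` of neighbours of `S`. -/
def nbrs (I : SSVE) (S : Finset (Fin I.nU)) : Finset (Fin I.nV) :=
  Finset.univ.filter fun v => ∃ u ∈ S, (u, v) ∈ I.edges

def Feasible (I : SSVE) (S : Finset (Fin I.nU)) : Prop := I.α * (I.nU : ℚ≥0) ≤ (S.card : ℚ≥0)

def value (I : SSVE) (S : Finset (Fin I.nU)) : ℕ := (I.nbrs S).card

/-- There is a polynomial-time `σ(m, n)`-approximation algorithm. -/
def HasApprox (σ : ℕ → ℕ → ℝ) : Prop :=
  ∃ A : (I : SSVE) → Finset (Fin I.nU),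
    PolyTime enc (fun I => encSet (A I)) ∧
      ∀ I : SSVE, I.Feasible (A I) ∧
        ∀ S, I.Feasible S → (I.value (A I) : ℝ) ≤ σ I.m I.n * (I.value S : ℝ)

end SSVE

/-! ### `k`-route `s`-`t` cut -/

/-- An undirected multigraph on `Fin n` with nonnegative edge costs, given by its list of
edges `(u, v, cost)` (repetitions are parallel edges), two distinct terminals and `k ≥ 1`. -/
structure STCut where
  n : ℕ
  edges : List (Fin n × Fin n × ℚ≥0)
  loopless : ∀ e ∈ edges, e.1 ≠ e.2.1
  s : Fin n
  t : Fin n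
  s_ne_t : s ≠ t
  k : ℕ
  one_le_k : 1 ≤ k

namespace STCut

/-- Number of edges, counted with multiplicity. -/
def m (I : STCut) : ℕ := I.edges.length

def enc (I : STCut) : Data :=
  .pair (encUnary I.n) (.pair
    (encList (I.edges.map fun e => .pair (.nat e.1) (.pair (.nat e.2.1) (encRat e.2.2))))
    (.pair (.nat I.s) (.pair (.nat I.t) (.nat I.k))))

/-- The edge with index `e`. -/
def edge (I : STCut) (e : Fin I.m) : Fin I.n × Fin I.n × ℚ≥0 := I.edges.get e

/-- The edge with index `e` has the end points `u` and `v`. -/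
def Joins (I : STCut) (e : Fin I.m) (u v : Fin I.n) : Prop :=
  ((I.edge e).1 = u ∧ (I.edge e).2.1 = v) ∨ ((I.edge e).1 = v ∧ (I.edge e).2.1 = u)

/-- `IsWalk u vs es v`: a walk from `u` to `v` with vertex sequence `vs` and edge
sequence `es`. -/
inductive IsWalk (I : STCut) : Fin I.n → List (Fin I.n) → List (Fin I.m) → Fin I.n → Prop
  | nil (v : Fin I.n) : IsWalk I v [v] [] v
  | cons {e : Fin I.m} {u w v : Fin I.n} {vs : List (Fin I.n)} {es : List (Fin I.m)} :
      I.Joins e u w → IsWalk I w vs es v → IsWalk I u (u :: vs) (e :: es) v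

/-- `es` is the edge sequence of an `s`-`t` path. -/
def IsSTPath (I : STCut) (es : List (Fin I.m)) : Prop :=
  ∃ vs, I.IsWalk I.s vs es I.t ∧ vs.Nodup

/-- After deletion of `F` there are at most `k - 1` edge-disjoint `s`-`t` paths. -/
def Feasible (I : STCut) (F : Finset (Fin I.m)) : Prop :=
  ∀ (r : ℕ) (P : Fin r → List (Fin I.m)),
    (∀ i, I.IsSTPath (P i) ∧ ∀ e ∈ P i, e ∉ F) →
    (∀ i j, i ≠ j → List.Disjoint (P i) (P j)) → r < I.k

def cost (I : STCut) (F : Finset (Fin I.m)) : ℚ≥0 := ∑ e ∈ F, (I.edge e).2.2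

/-- There is a polynomial-time `ρ(k, m, n)`-approximation algorithm. -/
def HasApprox (ρ : ℕ → ℕ → ℕ → ℝ) : Prop :=
  ∃ A : (I : STCut) → Finset (Fin I.m),
    PolyTime enc (fun I => encSet (A I)) ∧
      ∀ I : STCut, I.Feasible (A I) ∧
        ∀ F, I.Feasible F → (I.cost (A I) : ℝ) ≤ ρ I.k I.m I.n * (I.cost F : ℝ)

end STCut

/-! ### Densest `k`-subgraph on uniform hypergraphs -/

/-- An `l`-uniform hypergraph on `Fin n`, and the number `k ≤ n` of nodes to choose. -/
structure DkS (l : ℕ) where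
  n : ℕ
  hyperedges : List (Finset (Fin n))
  nodup : hyperedges.Nodup
  uniform : ∀ e ∈ hyperedges, e.card = l
  k : ℕ
  k_le : k ≤ n

namespace DkS

def m {l : ℕ} (I : DkS l) : ℕ := I.hyperedges.length

def enc {l : ℕ} (I : DkS l) : Data :=
  .pair (encUnary I.n) (.pair (encList (I.hyperedges.map encSet)) (.nat I.k))

/-- The number of hyperedges contained in `T`. -/
def value {l : ℕ} (I : DkS l) (T : Finset (Fin I.n)) : ℕ :=
  (I.hyperedges.filter fun e => e ⊆ T).length

/-- There is a polynomial-time `τ(m, n)`-approximation algorithm on `l`-uniform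
hypergraphs. -/
def HasApprox (l : ℕ) (τ : ℕ → ℕ → ℝ) : Prop :=
  ∃ A : (I : DkS l) → Finset (Fin I.n),
    PolyTime enc (fun I => encSet (A I)) ∧
      ∀ I : DkS l, (A I).card = I.k ∧
        ∀ T : Finset (Fin I.n), T.card = I.k →
          (I.value T : ℝ) ≤ τ I.m I.n * (I.value (A I) : ℝ)

end DkS

/-- `r` bounds `ρ` on all arguments up to `c m n²`, `c (m n² + n⁵)`, `c n³`. If `ρ` is
monotone this says `ρ (c m n²) (c (m n² + n⁵)) (c n³) ≤ r`. -/
def BoundsRatio (ρ : ℕ → ℕ → ℕ → ℝ) (c m n : ℕ) (r : ℝ) : Prop :=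
  ∀ k' m' n' : ℕ, k' ≤ c * (m * n ^ 2) → m' ≤ c * (m * n ^ 2 + n ^ 5) → n' ≤ c * n ^ 3 →
    ρ k' m' n' ≤ r

end KRoute

open KRoute

namespace KRoute

/-! ### Polynomial-time computation: closure properties -/

/-! Reduction. The cut instance has a node for every `u` and `v`, a source `s` and a sink `t`. Every
`v` is joined to `t` by `M = n ^ 3 + 1` parallel edges of cost 1. There is an edge `s-u` for every
`u`, and for every edge `e = (u, v)` of the bipartite graph a private path `s-v-u-t`; these edges
cost `|V| * M`, as much as all the cheap edges together. If `q` is the least size of a feasible set,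
then `k - 1 = m + (|U| - q)`, and `B = M`.

From `S` to a cut (`feasible_toCut`): delete the cheap edges at `Γ(S)`. Around `{s} ∪ S ∪ Γ(S)` each
private path crosses the boundary exactly once, because `u ∈ S` forces `v ∈ Γ(S)`, and the only
other surviving crossing edges are `s-u` with `u ∉ S`. This leaves at most `m + |U| - |S| ≤ k - 1`
crossing edges.

From a cut to `S` (`feasible_fromCut`, `value_fromCut_le`): if only cheap edges are deleted, let `S`
consist of the `u` all of whose neighbours have fewer than `|U|` cheap edges left. Each `u ∉ S` has
an edge to some `v` with at least `|U|` cheap edges left. The private path of that edge is rerouted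
as `s-v-t`, which frees its edge `u-t` for an extra path `s-u-t`. There are then `m + |U| - |S|`
disjoint paths, so feasibility of the cut gives `|S| ≥ q`. Every vertex of `Γ(S)` has lost more than
`M - |U|` cheap edges, hence `|Γ(S)| * M ≤ cost + |U| * |V|`. Since `M` exceeds both `|U| * |V|` and
`n * |U| * |V|`, the error disappears under integer rounding and is at most `1 / n` in general. A
cut with an expensive edge already pays for all of `V`, so `S = U` is good enough.

Densest subgraph. For each possible optimum `j + 1`, apply the SSVE algorithm to the incidence graph
of hyperedges and nodes, asking for `j + 1` hyperedges. For the correct guess it yields a node set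
`Q` spanning at least the optimal number of hyperedges with `|Q| ≤ σ * k + 1 / (m + n)`. If `|Q| ≤
k`, add nodes. Otherwise delete the best node repeatedly; by averaging (`sum_value_erase`) the value
shrinks at most by the ratio of the falling factorials of `k` and `|Q|` of order `l`. For `k ≥ 2 * l
^ 2` that of `k` is at least `k ^ l / 2`, and that of `|Q|` is at most `(σ * k) ^ l`, because a
falling factorial has enough slack below the power to absorb the additive `1 / (m + n)`. For smaller
`k` all small sets are tried.

Polynomial time is shown by closure properties of `PolyTime`. It speaks of indexed families, so an
extra local variable is handled by passing to a sigma type and pairing its encoding with the input;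
everything rests on one loop rule, `PolyTime.loop`. -/

theorem eval_mono (P : Polynomial ℕ) {a b : ℕ} (h : a ≤ b) : P.eval a ≤ P.eval b := by
  rw [Polynomial.eval_eq_sum_range, Polynomial.eval_eq_sum_range]
  gcongr

theorem Data.one_le_size (x : Data) : 1 ≤ x.size := by
  cases x <;> simp only [Data.size] <;> omega

/-- Every elementary step is charged for its argument and its result. This is what makes polynomial
time closed under composition: the second program runs on a value no longer than the running time of
the first. -/
theorem Eval.size_le {p : Prog} {x y : Data} {t : ℕ} (h : Eval p x y t) :
    x.size ≤ t ∧ y.size ≤ t := by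
  induction h with
  | op o x => omega
  | pair _ _ ih₁ ih₂ => simp only [Data.size]; omega
  | seq _ _ ih₁ ih₂ => omega
  | ite_true _ _ _ ih₁ ih₂ => omega
  | ite_false _ _ ih₁ ih₂ => omega
  | loop_stop _ ih => omega
  | loop_step _ _ _ _ ih₁ ih₂ ih₃ => omega

namespace PolyTime

variable {ι κ : Type*} {inp mid out a b : ι → Data}

theorem size_bound (h : PolyTime inp out) :
    ∃ Q : Polynomial ℕ, ∀ i, (out i).size ≤ Q.eval (inp i).size := by
  obtain ⟨p, P, hP⟩ := h
  refine ⟨P, fun i => ?_⟩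
  obtain ⟨t, ht, he⟩ := hP i
  exact he.size_le.2.trans ht

theorem reindex (h : PolyTime inp out) (φ : κ → ι) :
    PolyTime (fun k => inp (φ k)) (fun k => out (φ k)) := by
  obtain ⟨p, P, hP⟩ := h
  exact ⟨p, P, fun k => hP (φ k)⟩

theorem congr (h : PolyTime inp out) {inp' out' : ι → Data} (hi : ∀ i, inp' i = inp i)
    (ho : ∀ i, out' i = out i) : PolyTime inp' out' := by
  rwa [funext hi, funext ho]

theorem congr_out (h : PolyTime inp out) {out' : ι → Data} (ho : ∀ i, out' i = out i) :
    PolyTime inp out' := h.congr (fun _ => rfl) ho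

theorem comp (h₁ : PolyTime inp mid) (h₂ : PolyTime mid out) : PolyTime inp out := by
  obtain ⟨p, P, hP⟩ := h₁
  obtain ⟨q, Q, hQ⟩ := h₂
  refine ⟨.seq p q, P + Q.comp P + 1, fun i => ?_⟩
  obtain ⟨t, ht, he⟩ := hP i
  obtain ⟨u, hu, he'⟩ := hQ i
  refine ⟨t + u + 1, ?_, he.seq he'⟩
  have := eval_mono Q (he.size_le.2.trans ht)
  simp only [Polynomial.eval_add, Polynomial.eval_comp, Polynomial.eval_one]
  omega

theorem pair (h₁ : PolyTime inp a) (h₂ : PolyTime inp b) :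
    PolyTime inp (fun i => .pair (a i) (b i)) := by
  obtain ⟨p, P, hP⟩ := h₁
  obtain ⟨q, Q, hQ⟩ := h₂
  refine ⟨.pair p q, P + Q + 1, fun i => ?_⟩
  obtain ⟨t, ht, he⟩ := hP i
  obtain ⟨u, hu, he'⟩ := hQ i
  refine ⟨t + u + 1, ?_, he.pair he'⟩
  simp only [Polynomial.eval_add, Polynomial.eval_one]
  omega

theorem of_op (o : Op) (ho : ∃ Q : Polynomial ℕ, ∀ i, (o.apply (inp i)).size ≤ Q.eval (inp i).size) :
    PolyTime inp (fun i => o.apply (inp i)) := by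
  obtain ⟨Q, hQ⟩ := ho
  refine ⟨.op o, 1 + .X + Q, fun i => ⟨_, ?_, .op o (inp i)⟩⟩
  have := hQ i
  simp only [Polynomial.eval_add, Polynomial.eval_one, Polynomial.eval_X]
  omega

theorem refl (inp : ι → Data) : PolyTime inp inp :=
  of_op (inp := inp) .id ⟨.X, fun i => by simp [Op.apply]⟩

theorem natConst (n : ℕ) : PolyTime inp (fun _ => .nat n) :=
  of_op (inp := inp) (.const n) ⟨.C (1 + Nat.size n), fun i => by simp [Op.apply, Data.size]⟩

theorem fst_proj : PolyTime (fun i => .pair (a i) (b i)) a :=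
  of_op (inp := fun i => .pair (a i) (b i)) .fst
    ⟨.X, fun i => by simp only [Op.apply, Data.size, Polynomial.eval_X]; omega⟩

theorem snd_proj : PolyTime (fun i => .pair (a i) (b i)) b :=
  of_op (inp := fun i => .pair (a i) (b i)) .snd
    ⟨.X, fun i => by simp only [Op.apply, Data.size, Polynomial.eval_X]; omega⟩

theorem fst (h : PolyTime inp (fun i => .pair (a i) (b i))) : PolyTime inp a := h.comp fst_proj

theorem snd (h : PolyTime inp (fun i => .pair (a i) (b i))) : PolyTime inp b := h.comp snd_proj

/-- For work under a binder: a computation from the outer input remains available once a local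
variable is paired with it. -/
theorem lift (h : PolyTime inp out) (φ : κ → ι) {c : κ → Data} :
    PolyTime (fun k => .pair (inp (φ k)) (c k)) (fun k => out (φ k)) :=
  fst_proj.comp (h.reindex φ)

section Arith

variable {x y : ι → ℕ}

theorem natOp (o : Op) (g : ℕ → ℕ → ℕ)
    (ho : ∀ u v, o.apply (.pair (.nat u) (.nat v)) = .nat (g u v))
    (hg : ∀ u v, Nat.size (g u v) ≤ Nat.size u + Nat.size v + 1)
    (hx : PolyTime inp (fun i => .nat (x i))) (hy : PolyTime inp (fun i => .nat (y i))) :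
    PolyTime inp (fun i => .nat (g (x i) (y i))) := by
  have h := of_op (inp := fun i => Data.pair (.nat (x i)) (.nat (y i))) o
    ⟨.X, fun i => by
      have := hg (x i) (y i)
      simp only [ho, Data.size, Polynomial.eval_X]; omega⟩
  simp only [ho] at h
  exact (hx.pair hy).comp h

theorem size_add_le (u v : ℕ) : Nat.size (u + v) ≤ Nat.size u + Nat.size v + 1 := by
  rw [Nat.size_le]
  have hu := Nat.lt_size_self u
  have hv := Nat.lt_size_self v
  have h₁ : 2 ^ Nat.size u ≤ 2 ^ (Nat.size u + Nat.size v) :=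
    Nat.pow_le_pow_right (by norm_num) (by omega)
  have h₂ : 2 ^ Nat.size v ≤ 2 ^ (Nat.size u + Nat.size v) :=
    Nat.pow_le_pow_right (by norm_num) (by omega)
  rw [pow_succ]
  omega

theorem size_mul_le (u v : ℕ) : Nat.size (u * v) ≤ Nat.size u + Nat.size v + 1 := by
  rw [Nat.size_le]
  have hu := Nat.lt_size_self u
  have hv := Nat.lt_size_self v
  calc u * v < 2 ^ Nat.size u * 2 ^ Nat.size v := Nat.mul_lt_mul'' hu hv
    _ ≤ 2 ^ (Nat.size u + Nat.size v + 1) := by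
      rw [← pow_add]; exact Nat.pow_le_pow_right (by norm_num) (by omega)

theorem add (hx : PolyTime inp (fun i => .nat (x i))) (hy : PolyTime inp (fun i => .nat (y i))) :
    PolyTime inp (fun i => .nat (x i + y i)) :=
  natOp .add (· + ·) (fun _ _ => rfl) size_add_le hx hy

theorem sub (hx : PolyTime inp (fun i => .nat (x i))) (hy : PolyTime inp (fun i => .nat (y i))) :
    PolyTime inp (fun i => .nat (x i - y i)) :=
  natOp .sub (· - ·) (fun _ _ => rfl) (fun u v => by
    have := Nat.size_le_size (Nat.sub_le u v); omega) hx hy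

theorem mul (hx : PolyTime inp (fun i => .nat (x i))) (hy : PolyTime inp (fun i => .nat (y i))) :
    PolyTime inp (fun i => .nat (x i * y i)) :=
  natOp .mul (· * ·) (fun _ _ => rfl) size_mul_le hx hy

theorem div (hx : PolyTime inp (fun i => .nat (x i))) (hy : PolyTime inp (fun i => .nat (y i))) :
    PolyTime inp (fun i => .nat (x i / y i)) :=
  natOp .div (· / ·) (fun _ _ => rfl) (fun u v => by
    have := Nat.size_le_size (Nat.div_le_self u v); omega) hx hy

theorem ite_ne_zero (hx : PolyTime inp (fun i => .nat (x i))) (ha : PolyTime inp a)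
    (hb : PolyTime inp b) : PolyTime inp (fun i => if x i = 0 then b i else a i) := by
  obtain ⟨p, P, hP⟩ := hx
  obtain ⟨q, Q, hQ⟩ := ha
  obtain ⟨r, R, hR⟩ := hb
  refine ⟨.ite p q r, P + Q + R + 1, fun i => ?_⟩
  obtain ⟨t, ht, he⟩ := hP i
  simp only [Polynomial.eval_add, Polynomial.eval_one]
  by_cases h : x i = 0
  · obtain ⟨u, hu, he'⟩ := hR i
    simp only [h] at he
    exact ⟨t + u + 1, by omega, by simpa [h] using he.ite_false he'⟩
  · obtain ⟨u, hu, he'⟩ := hQ i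
    exact ⟨t + u + 1, by omega, by simpa [h] using he.ite_true (by simpa using h) he'⟩

variable {c d : ι → Prop} [DecidablePred c] [DecidablePred d]

theorem ite (hc : PolyTime inp (fun i => .nat (if c i then 1 else 0))) (ha : PolyTime inp a)
    (hb : PolyTime inp b) : PolyTime inp (fun i => if c i then a i else b i) := by
  refine (ite_ne_zero hc ha hb).congr_out fun i => ?_
  by_cases h : c i <;> simp [h]

theorem natIte (hc : PolyTime inp (fun i => .nat (if c i then 1 else 0)))
    (hx : PolyTime inp (fun i => .nat (x i))) (hy : PolyTime inp (fun i => .nat (y i))) :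
    PolyTime inp (fun i => .nat (if c i then x i else y i)) := by
  refine PolyTime.congr_out (ite hc hx hy) fun i => ?_
  by_cases h : c i <;> simp [h]

theorem decide_zero (hx : PolyTime inp (fun i => .nat (x i))) :
    PolyTime inp (fun i => .nat (if x i = 0 then 1 else 0)) := by
  refine PolyTime.congr_out (ite_ne_zero hx (natConst 0) (natConst 1)) fun i => ?_
  by_cases h : x i = 0 <;> simp [h]

theorem decide_le (hx : PolyTime inp (fun i => .nat (x i)))
    (hy : PolyTime inp (fun i => .nat (y i))) :
    PolyTime inp (fun i => .nat (if x i ≤ y i then 1 else 0)) := by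
  simpa only [Nat.sub_eq_zero_iff_le] using decide_zero (hx.sub hy)

theorem decide_lt (hx : PolyTime inp (fun i => .nat (x i)))
    (hy : PolyTime inp (fun i => .nat (y i))) :
    PolyTime inp (fun i => .nat (if x i < y i then 1 else 0)) := by
  simpa only [Nat.succ_le_iff] using decide_le (hx.add (natConst 1)) hy

theorem decide_and (hc : PolyTime inp (fun i => .nat (if c i then 1 else 0)))
    (hd : PolyTime inp (fun i => .nat (if d i then 1 else 0))) :
    PolyTime inp (fun i => .nat (if c i ∧ d i then 1 else 0)) := by
  refine PolyTime.congr_out (hc.mul hd) fun i => ?_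
  by_cases h : c i <;> by_cases h' : d i <;> simp [h, h']

theorem decide_eq (hx : PolyTime inp (fun i => .nat (x i)))
    (hy : PolyTime inp (fun i => .nat (y i))) :
    PolyTime inp (fun i => .nat (if x i = y i then 1 else 0)) := by
  simpa only [le_antisymm_iff] using decide_and (decide_le hx hy) (decide_le hy hx)

end Arith

/-! ### Loops over lists -/

/-- The first component `r` of the state doubles as the loop condition. The body need only be
correct on states that are really reached, and polynomial time follows from polynomial bounds on the
number of rounds and on the length of all states; without the latter, repeated squaring would be a
counterexample. -/
theorem loop {inp : ι → Data} {N : ι → ℕ} {s r : ι → ℕ → Data}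
    (h₀ : PolyTime inp (fun i => .pair (r i 0) (s i 0)))
    (hr : ∀ i j, j < N i → r i j ≠ .nat 0) (hr' : ∀ i, r i (N i) = .nat 0)
    (hs : PolyTime (fun p : (i : ι) × Fin (N i) => .pair (r p.1 p.2) (s p.1 p.2))
      (fun p => .pair (r p.1 (p.2 + 1)) (s p.1 (p.2 + 1))))
    (hN : ∃ R : Polynomial ℕ, ∀ i, N i ≤ R.eval (inp i).size)
    (hb : ∃ Q : Polynomial ℕ, ∀ i j, j ≤ N i →
      (Data.pair (r i j) (s i j)).size ≤ Q.eval (inp i).size) :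
    PolyTime inp (fun i => s i (N i)) := by
  suffices h : PolyTime inp (fun i => .pair (r i (N i)) (s i (N i))) from h.snd
  obtain ⟨p₀, P₀, hP₀⟩ := h₀
  obtain ⟨p, P, hP⟩ := hs
  obtain ⟨R, hR⟩ := hN
  obtain ⟨Q, hQ⟩ := hb
  refine ⟨.seq p₀ (.loop (.op .fst) p),
    P₀ + ((R + 1) * (P.comp Q + 2 * Q + 2)) + 1, fun i => ?_⟩
  obtain ⟨t₀, ht₀, he₀⟩ := hP₀ i
  have hcond : ∀ j ≤ N i, ∃ t ≤ 2 * Q.eval (inp i).size + 1,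
      Eval (.op .fst) (.pair (r i j) (s i j)) (r i j) t := by
    intro j hj
    refine ⟨_, ?_, .op .fst _⟩
    have := hQ i j hj
    simp only [Op.apply, Data.size] at this ⊢
    omega
  -- Induction on the number `d` of remaining rounds, since `Eval` unfolds a loop from its start.
  have key : ∀ d ≤ N i, ∃ t ≤ (d + 1) * (P.eval (Q.eval (inp i).size) + 2 * Q.eval (inp i).size + 2),
      Eval (.loop (.op .fst) p) (.pair (r i (N i - d)) (s i (N i - d)))
        (.pair (r i (N i)) (s i (N i))) t := by
    intro d
    induction d with
    | zero =>
      intro _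
      obtain ⟨t, ht, he⟩ := hcond (N i) le_rfl
      rw [hr'] at he
      refine ⟨t + 1, by omega, ?_⟩
      rw [Nat.sub_zero, hr']
      exact Eval.loop_stop he
    | succ d ih =>
      intro hd
      obtain ⟨v, hv, hev⟩ := ih (by omega)
      obtain ⟨t, ht, he⟩ := hcond (N i - (d + 1)) (by omega)
      obtain ⟨u, hu, heu⟩ := hP ⟨i, ⟨N i - (d + 1), by omega⟩⟩
      have hu' := hu.trans (eval_mono P (hQ i (N i - (d + 1)) (by omega)))
      have e : N i - (d + 1) + 1 = N i - d := by omega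
      simp only [e] at heu
      refine ⟨t + u + v + 1, ?_, .loop_step he (hr i _ (by omega)) heu hev⟩
      rw [add_mul (d + 1) 1]
      omega
  obtain ⟨t, ht, he⟩ := key (N i) le_rfl
  rw [Nat.sub_self] at he
  refine ⟨t₀ + t + 1, ?_, he₀.seq he⟩
  have h₁ := hR i
  have h₂ : (N i + 1) * (P.eval (Q.eval (inp i).size) + 2 * Q.eval (inp i).size + 2) ≤
      (R.eval (inp i).size + 1) * (P.eval (Q.eval (inp i).size) + 2 * Q.eval (inp i).size + 2) := by
    gcongr
  simp only [Polynomial.eval_add, Polynomial.eval_mul, Polynomial.eval_comp, Polynomial.eval_one,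
    Polynomial.eval_ofNat]
  omega

end PolyTime

/-! ### Lengths of encoded lists -/

theorem size_encList (l : List Data) : (encList l).size = 1 + (l.map fun d => 1 + d.size).sum := by
  induction l with
  | nil => simp [encList, Data.size]
  | cons d l ih => simp only [encList, Data.size, ih, List.map_cons, List.sum_cons]; omega

theorem length_le_size (l : List Data) : l.length ≤ (encList l).size := by
  induction l with
  | nil => simp
  | cons d l ih => simp only [encList, Data.size, List.length_cons]; omega

theorem size_encList_drop (l : List Data) (j : ℕ) :
    (encList (l.drop j)).size ≤ (encList l).size := by
  induction l generalizing j with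
  | nil => simp
  | cons d l ih =>
    cases j with
    | zero => simp
    | succ j => have := ih j; simp only [List.drop_succ_cons, encList, Data.size]; omega

namespace PolyTime

variable {ι : Type*} {inp : ι → Data}

/-- The unread part of the list serves as the loop condition: only the empty list is encoded as the
number `0`. -/
theorem iterate {l : ι → List Data} {acc : ι → ℕ → Data}
    (hl : PolyTime inp (fun i => encList (l i))) (h₀ : PolyTime inp (fun i => acc i 0))
    (hs : PolyTime (fun p : (i : ι) × Fin (l i).length =>
      .pair (inp p.1) (.pair ((l p.1).get p.2) (acc p.1 p.2))) (fun p => acc p.1 (p.2 + 1)))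
    (hb : ∃ Q : Polynomial ℕ, ∀ i j, j ≤ (l i).length → (acc i j).size ≤ Q.eval (inp i).size) :
    PolyTime inp (fun i => acc i (l i).length) := by
  refine PolyTime.snd (a := inp) (loop (N := fun i => (l i).length)
    (r := fun i j => encList ((l i).drop j)) (s := fun i j => .pair (inp i) (acc i j))
    ?_ ?_ ?_ ?_ ?_ ?_)
  · simpa using hl.pair ((refl inp).pair h₀)
  · intro i j hj
    rw [List.drop_eq_getElem_cons hj]
    simp [encList]
  · intro i
    simp [encList]
  · have e : ∀ p : (i : ι) × Fin (l i).length, encList ((l p.1).drop p.2) =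
        .pair ((l p.1).get p.2) (encList ((l p.1).drop (p.2 + 1))) := by
      intro p
      rw [List.drop_eq_getElem_cons p.2.2]
      simp [encList]
    simp only [e]
    have h := refl (fun p : (i : ι) × Fin (l i).length => Data.pair (.pair ((l p.1).get p.2)
      (encList ((l p.1).drop (p.2 + 1)))) (.pair (inp p.1) (acc p.1 p.2)))
    exact h.fst.snd.pair (h.snd.fst.pair ((h.snd.fst.pair (h.fst.fst.pair h.snd.snd)).comp hs))
  · obtain ⟨Q, hQ⟩ := hl.size_bound
    exact ⟨Q, fun i => (length_le_size _).trans (hQ i)⟩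
  · obtain ⟨Q, hQ⟩ := hl.size_bound
    obtain ⟨Q', hQ'⟩ := hb
    refine ⟨2 + Q + .X + Q', fun i j hj => ?_⟩
    have h₁ := hQ i
    have h₂ := hQ' i j hj
    have h₃ := size_encList_drop (l i) j
    simp only [Data.size, Polynomial.eval_add, Polynomial.eval_X, Polynomial.eval_ofNat]
    omega

theorem foldl {α σ : ι → Type*} {l : ∀ i, List (α i)} {e : ∀ i, α i → Data}
    {es : ∀ i, σ i → Data} {init : ∀ i, σ i} {f : ∀ i, σ i → α i → σ i}
    (hl : PolyTime inp (fun i => encList ((l i).map (e i))))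
    (h₀ : PolyTime inp (fun i => es i (init i)))
    (hs : PolyTime (fun p : (i : ι) × α i × σ i =>
      .pair (inp p.1) (.pair (e p.1 p.2.1) (es p.1 p.2.2)))
      (fun p => es p.1 (f p.1 p.2.2 p.2.1)))
    (hb : ∃ Q : Polynomial ℕ, ∀ i j, (es i (((l i).take j).foldl (f i) (init i))).size ≤
      Q.eval (inp i).size) :
    PolyTime inp (fun i => es i ((l i).foldl (f i) (init i))) := by
  have := iterate (acc := fun i j => es i (((l i).take j).foldl (f i) (init i))) hl
    (by simpa using h₀) ?_ ?_
  · simpa using this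
  · have h := hs.reindex (fun p : (i : ι) × Fin ((l i).map (e i)).length =>
      (⟨p.1, (l p.1)[p.2]'(by simpa using p.2.2),
        ((l p.1).take p.2).foldl (f p.1) (init p.1)⟩ : (i : ι) × α i × σ i))
    refine h.congr (fun p => ?_) (fun p => ?_)
    · simp
    · have hp : p.2.1 < (l p.1).length := by simpa using p.2.2
      rw [List.take_succ_eq_append_getElem hp, List.foldl_append]
      simp
  · obtain ⟨Q, hQ⟩ := hb
    exact ⟨Q, fun i j _ => hQ i j⟩

end PolyTime

theorem size_encList_append (l l' : List Data) :
    (encList (l ++ l')).size + 1 = (encList l).size + (encList l').size := by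
  simp only [size_encList, List.map_append, List.sum_append]; omega

theorem size_encList_reverse (l : List Data) : (encList l.reverse).size = (encList l).size := by
  simp only [size_encList, List.map_reverse, List.sum_reverse]

theorem size_encList_take (l : List Data) (j : ℕ) :
    (encList (l.take j)).size ≤ (encList l).size := by
  have := size_encList_append (l.take j) (l.drop j)
  rw [List.take_append_drop] at this
  have := Data.one_le_size (encList (l.drop j))
  omega

theorem size_encList_le (l : List Data) (b : ℕ) (h : ∀ d ∈ l, d.size ≤ b) :
    (encList l).size ≤ 1 + l.length * (1 + b) := by
  rw [size_encList]
  have := List.sum_le_card_nsmul (l.map fun d => 1 + d.size) (1 + b) (by simpa using h)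
  simp only [List.length_map, smul_eq_mul] at this
  omega

theorem size_mem_le {l : List Data} {d : Data} (h : d ∈ l) : d.size ≤ (encList l).size := by
  rw [size_encList]
  have := List.single_le_sum (l := l.map fun d => 1 + d.size) (by simp) (1 + d.size)
    (List.mem_map_of_mem h)
  omega

/-! ### List operations and unary arithmetic in polynomial time -/

namespace PolyTime

variable {ι : Type*} {inp : ι → Data}

theorem revAppend {l l' : ι → List Data} (hl : PolyTime inp (fun i => encList (l i)))
    (hl' : PolyTime inp (fun i => encList (l' i))) :
    PolyTime inp (fun i => encList ((l i).reverse ++ l' i)) := by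
  have e : ∀ (a b : List Data), a.foldl (fun s x => x :: s) b = a.reverse ++ b := by
    intro a
    induction a with
    | nil => simp
    | cons x a ih => intro b; simp [ih]
  have := foldl (inp := inp) (α := fun _ => Data) (σ := fun _ => List Data) (l := l)
    (e := fun _ d => d) (es := fun _ d => encList d) (init := l') (f := fun _ s x => x :: s)
    (by simpa using hl) hl' ?_ ?_
  · simpa only [e] using this
  · exact (refl _).snd
  · obtain ⟨Q, hQ⟩ := hl.size_bound
    obtain ⟨Q', hQ'⟩ := hl'.size_bound
    refine ⟨Q + Q', fun i j => ?_⟩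
    rw [e]
    have h₁ := size_encList_append ((l i).take j).reverse (l' i)
    rw [size_encList_reverse] at h₁
    have h₂ := size_encList_take (l i) j
    have h₃ := hQ i
    have h₄ := hQ' i
    simp only [Polynomial.eval_add]
    omega

theorem nil : PolyTime inp (fun _ => encList []) := natConst 0

theorem cons {d : ι → Data} {l : ι → List Data} (hd : PolyTime inp d)
    (hl : PolyTime inp (fun i => encList (l i))) : PolyTime inp (fun i => encList (d i :: l i)) :=
  hd.pair hl

theorem reverse {l : ι → List Data} (hl : PolyTime inp (fun i => encList (l i))) :
    PolyTime inp (fun i => encList (l i).reverse) := by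
  simpa using revAppend hl nil

theorem append {l l' : ι → List Data} (hl : PolyTime inp (fun i => encList (l i)))
    (hl' : PolyTime inp (fun i => encList (l' i))) :
    PolyTime inp (fun i => encList (l i ++ l' i)) := by
  simpa using revAppend (reverse hl) hl'

theorem map {α : ι → Type*} {l : ∀ i, List (α i)} {e g : ∀ i, α i → Data}
    (hl : PolyTime inp (fun i => encList ((l i).map (e i))))
    (hg : PolyTime (fun p : (i : ι) × α i => .pair (inp p.1) (e p.1 p.2))
      (fun p => g p.1 p.2)) :
    PolyTime inp (fun i => encList ((l i).map (g i))) := by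
  have e' : ∀ i (a : List (α i)) b, a.foldl (fun s x => g i x :: s) b =
      (a.map (g i)).reverse ++ b := by
    intro i a
    induction a with
    | nil => simp
    | cons x a ih => intro b; simp [ih]
  have := foldl (inp := inp) (σ := fun _ => List Data) (l := l)
    (e := e) (es := fun _ d => encList d) (init := fun _ => []) (f := fun i s x => g i x :: s)
    hl nil ?_ ?_
  · simp only [e', List.append_nil] at this
    simpa using reverse this
  · have h := refl (fun p : (i : ι) × α i × List Data =>
      Data.pair (inp p.1) (.pair (e p.1 p.2.1) (encList p.2.2)))
    exact cons ((h.fst.pair h.snd.fst).comp (hg.reindex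
      fun p : (i : ι) × α i × List Data => ⟨p.1, p.2.1⟩)) h.snd.snd
  · obtain ⟨Q, hQ⟩ := hl.size_bound
    obtain ⟨Q', hQ'⟩ := hg.size_bound
    refine ⟨1 + Q * (1 + Q'.comp (1 + .X + Q)), fun i j => ?_⟩
    simp only [e', List.append_nil, size_encList_reverse, Polynomial.eval_add,
      Polynomial.eval_mul, Polynomial.eval_comp, Polynomial.eval_one, Polynomial.eval_X]
    rw [List.map_take]
    refine (size_encList_take _ _).trans ((size_encList_le _
      (Q'.eval (1 + (inp i).size + Q.eval (inp i).size)) ?_).trans ?_)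
    · intro d hd
      obtain ⟨x, hx, rfl⟩ := List.mem_map.1 hd
      refine (hQ' ⟨i, x⟩).trans (eval_mono _ ?_)
      have h₁ := size_mem_le (List.mem_map_of_mem (f := e i) hx)
      have h₂ := hQ i
      simp only [Data.size]
      omega
    · have h₁ := length_le_size ((l i).map (e i))
      have h₂ := hQ i
      rw [List.length_map] at h₁ ⊢
      gcongr
      exact h₁.trans h₂

theorem flatten {l : ι → List (List Data)}
    (hl : PolyTime inp (fun i => encList ((l i).map encList))) :
    PolyTime inp (fun i => encList (l i).flatten) := by
  have e : ∀ (a : List (List Data)) b, a.foldl (fun s x => x.reverse ++ s) b =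
      a.flatten.reverse ++ b := by
    intro a
    induction a with
    | nil => simp
    | cons x a ih => intro b; simp [ih]
  have := foldl (inp := inp) (α := fun _ => List Data) (σ := fun _ => List Data) (l := l)
    (e := fun _ => encList) (es := fun _ d => encList d) (init := fun _ => [])
    (f := fun i s x => x.reverse ++ s) hl nil ?_ ?_
  · simp only [e, List.append_nil] at this
    simpa using reverse this
  · exact revAppend (refl _).snd.fst (refl _).snd.snd
  · obtain ⟨Q, hQ⟩ := hl.size_bound
    refine ⟨Q, fun i j => ?_⟩
    simp only [e, List.append_nil, size_encList_reverse]
    refine le_trans ?_ ((size_encList_take _ j).trans (hQ i))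
    rw [← List.map_take]
    generalize (l i).take j = a
    induction a with
    | nil => simp
    | cons x a ih =>
      have := size_encList_append x a.flatten
      simp only [List.flatten_cons, List.map_cons, encList, Data.size]
      omega

theorem flatMap {α : ι → Type*} {l : ∀ i, List (α i)} {e : ∀ i, α i → Data}
    {g : ∀ i, α i → List Data} (hl : PolyTime inp (fun i => encList ((l i).map (e i))))
    (hg : PolyTime (fun p : (i : ι) × α i => .pair (inp p.1) (e p.1 p.2))
      (fun p => encList (g p.1 p.2))) :
    PolyTime inp (fun i => encList ((l i).flatMap (g i))) := by
  have := flatten (l := fun i => (l i).map (g i)) (by simpa using map hl hg)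
  simpa only [List.flatMap_def] using this

theorem size_sum_le (l : List ℕ) : Nat.size l.sum ≤ (encList (l.map Data.nat)).size := by
  induction l with
  | nil => simp
  | cons x l ih =>
    have := size_add_le x l.sum
    simp only [List.sum_cons, List.map_cons, encList, Data.size]
    omega

theorem sum {α : ι → Type*} {l : ∀ i, List (α i)} {w : ∀ i, α i → ℕ}
    (hl : PolyTime inp (fun i => encList ((l i).map fun a => .nat (w i a)))) :
    PolyTime inp (fun i => .nat ((l i).map (w i)).sum) := by
  have e : ∀ i (a : List (α i)) b, a.foldl (fun s x => s + w i x) b = b + (a.map (w i)).sum := by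
    intro i a
    induction a with
    | nil => simp
    | cons x a ih => intro b; simp [ih, add_assoc]
  have := foldl (inp := inp) (σ := fun _ => ℕ) (l := l)
    (e := fun i a => .nat (w i a)) (es := fun _ d => .nat d) (init := fun _ => 0)
    (f := fun i s x => s + w i x) hl (natConst 0) ?_ ?_
  · simpa only [e, Nat.zero_add] using this
  · exact (refl _).snd.snd.add (refl _).snd.fst
  · obtain ⟨Q, hQ⟩ := hl.size_bound
    refine ⟨1 + Q, fun i j => ?_⟩
    simp only [e, Nat.zero_add, Data.size, Polynomial.eval_add, Polynomial.eval_one]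
    have h₁ := size_sum_le (((l i).take j).map (w i))
    have h₂ := size_encList_take ((l i).map fun a => Data.nat (w i a)) j
    have h₃ := hQ i
    simp only [List.map_map, ← List.map_take] at h₁ h₂
    simp only [Function.comp_def] at h₁
    omega

theorem length {l : ι → List Data} (hl : PolyTime inp (fun i => encList (l i))) :
    PolyTime inp (fun i => .nat (l i).length) := by
  have := sum (l := l) (w := fun _ _ => 1)
    (map (α := fun _ => Data) (e := fun _ d => d) (g := fun _ _ => .nat 1) (by simpa using hl)
      (natConst 1))
  simpa using this

/-- Two encodings of the same underlying list are merged: the first drives the loop, and the second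
is consumed inside the accumulator. -/
theorem zip {α : ι → Type*} {l : ∀ i, List (α i)} {e e' : ∀ i, α i → Data}
    (hl : PolyTime inp (fun i => encList ((l i).map (e i))))
    (hl' : PolyTime inp (fun i => encList ((l i).map (e' i)))) :
    PolyTime inp (fun i => encList ((l i).map fun a => .pair (e i a) (e' i a))) := by
  have := iterate (inp := inp) (l := fun i => (l i).map (e i))
    (acc := fun i j => .pair (encList (((l i).map (e' i)).drop j))
      (encList (((l i).take j).map fun a => .pair (e i a) (e' i a)).reverse)) hl
      (by simpa using hl'.pair nil) ?_ ?_
  · simpa using reverse this.snd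
  · have h : ∀ p : (i : ι) × Fin ((l i).map (e i)).length, ∃ hp : p.2.1 < (l p.1).length,
        ((l p.1).map (e p.1)).get p.2 = e p.1 (l p.1)[p.2.1] ∧
        ((l p.1).map (e' p.1)).drop p.2 = e' p.1 (l p.1)[p.2.1] ::
          ((l p.1).map (e' p.1)).drop (p.2 + 1) ∧
        (((l p.1).take (p.2 + 1)).map fun a => Data.pair (e p.1 a) (e' p.1 a)).reverse =
          .pair (e p.1 (l p.1)[p.2.1]) (e' p.1 (l p.1)[p.2.1]) ::
            (((l p.1).take p.2).map fun a => Data.pair (e p.1 a) (e' p.1 a)).reverse := by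
      intro p
      have hp : p.2.1 < (l p.1).length := by simpa using p.2.2
      refine ⟨hp, by simp, ?_, ?_⟩
      · rw [List.drop_eq_getElem_cons (by simpa using hp)]
        simp
      · rw [List.take_succ_eq_append_getElem hp, List.map_append, List.reverse_append]
        rfl
    choose hp h₁ h₂ h₃ using h
    simp only [h₁, h₂, h₃]
    have h := refl (fun p : (i : ι) × Fin ((l i).map (e i)).length =>
      Data.pair (inp p.1) (.pair (e p.1 ((l p.1)[p.2.1]'(hp p)))
        (.pair (encList (e' p.1 ((l p.1)[p.2.1]'(hp p)) :: ((l p.1).map (e' p.1)).drop (p.2 + 1)))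
          (encList (((l p.1).take p.2).map fun a => Data.pair (e p.1 a) (e' p.1 a)).reverse))))
    exact h.snd.snd.fst.snd.pair (cons (h.snd.fst.pair h.snd.snd.fst.fst) h.snd.snd.snd)
  · obtain ⟨Q, hQ⟩ := hl.size_bound
    obtain ⟨Q', hQ'⟩ := hl'.size_bound
    refine ⟨1 + Q' + (Q + Q'), fun i j _ => ?_⟩
    have h₁ := hQ i
    have h₂ := hQ' i
    have h₃ := size_encList_drop ((l i).map (e' i)) j
    have h₄ := size_encList_take ((l i).map fun a => Data.pair (e i a) (e' i a)) j
    have h₅ : ∀ a : List (α i), (encList (a.map fun a => Data.pair (e i a) (e' i a))).size ≤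
        (encList (a.map (e i))).size + (encList (a.map (e' i))).size := by
      intro a
      induction a with
      | nil => simp [encList, Data.size]
      | cons x a ih => simp only [List.map_cons, encList, Data.size]; omega
    have h₆ := h₅ (l i)
    simp only [Data.size, Polynomial.eval_add, Polynomial.eval_one, size_encList_reverse,
      List.map_take]
    omega

theorem finRange {n : ι → ℕ} (hn : PolyTime inp (fun i => encUnary (n i))) :
    PolyTime inp (fun i => encList ((List.finRange (n i)).map fun j : Fin (n i) => .nat j.1)) := by
  have e : ∀ i, encList ((List.finRange (n i)).map fun j => .nat j.1) =
      encList ((List.range (n i)).map .nat) := by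
    intro i
    rw [← List.map_coe_finRange_eq_range, List.map_map]
    rfl
  simp only [e]
  have hn' : PolyTime inp (fun i => .nat (n i)) := by simpa using length hn
  -- Counts down from `n`, so that consing produces the list in increasing order. The unary encoding
  -- of `n` is what bounds the number of rounds.
  have := iterate (inp := inp) (l := fun i => List.replicate (n i) (.nat 0))
    (acc := fun i j => .pair (.nat (n i - j)) (encList (((List.range (n i)).drop (n i - j)).map .nat)))
    hn ((hn'.pair nil).congr_out fun i => by
      rw [Nat.sub_zero, List.drop_eq_nil_of_le (by simp), List.map_nil]) ?_ ?_
  · simpa using this.snd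
  · have h : ∀ p : (i : ι) × Fin (List.replicate (n i) (Data.nat 0)).length,
        ((List.range (n p.1)).drop (n p.1 - (p.2 + 1))).map Data.nat =
        .nat (n p.1 - p.2 - 1) :: ((List.range (n p.1)).drop (n p.1 - p.2)).map .nat := by
      intro p
      have hp : p.2.1 < n p.1 := by simpa using p.2.2
      rw [List.drop_eq_getElem_cons (by simp; omega)]
      have : n p.1 - (p.2.1 + 1) + 1 = n p.1 - p.2 := by omega
      simp [this, Nat.sub_sub]
    simp only [h]
    simp only [← Nat.sub_sub]
    have h' := refl (fun p : (i : ι) × Fin (List.replicate (n i) (Data.nat 0)).length =>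
      Data.pair (inp p.1) (.pair ((List.replicate (n p.1) (Data.nat 0)).get p.2)
        (.pair (.nat (n p.1 - p.2)) (encList (((List.range (n p.1)).drop (n p.1 - p.2)).map .nat)))))
    have h₁ := h'.snd.snd.fst.sub (natConst 1)
    exact h₁.pair (cons h₁ h'.snd.snd.snd)
  · obtain ⟨Q, hQ⟩ := hn'.size_bound
    obtain ⟨Q', hQ'⟩ := hn.size_bound
    refine ⟨1 + Q + (1 + Q' * (1 + Q)), fun i j _ => ?_⟩
    have h₁ := hQ i
    have h₂ := hQ' i
    have h₃ := length_le_size (List.replicate (n i) (.nat 0))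
    have h₀ : n i ≤ Q'.eval (inp i).size := by
      simp only [List.length_replicate] at h₃; exact h₃.trans h₂
    have h₄ := Nat.size_le_size (Nat.sub_le (n i) j)
    have h₅ := size_encList_drop ((List.range (n i)).map .nat) (n i - j)
    have h₆ := size_encList_le ((List.range (n i)).map .nat) (Q.eval (inp i).size) (by
      intro d hd
      obtain ⟨x, hx, rfl⟩ := List.mem_map.1 hd
      have := Nat.size_le_size (List.mem_range.1 hx).le
      simp only [Data.size] at h₁ ⊢
      omega)
    simp only [List.length_map, List.length_range] at h₆
    have h₇ : n i * (1 + Q.eval (inp i).size) ≤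
        Q'.eval (inp i).size * (1 + Q.eval (inp i).size) := by gcongr
    simp only [Data.size, Polynomial.eval_add, Polynomial.eval_one, Polynomial.eval_mul,
      List.map_drop] at h₁ ⊢
    omega

theorem unary_length {l : ι → List Data} (hl : PolyTime inp (fun i => encList (l i))) :
    PolyTime inp (fun i => encUnary (l i).length) := by
  have := map (α := fun _ => Data) (e := fun _ d => d) (g := fun _ _ => .nat 0) (l := l)
    (by simpa using hl) (natConst 0)
  simpa [encUnary] using this

theorem unary_add {x y : ι → ℕ} (hx : PolyTime inp (fun i => encUnary (x i)))
    (hy : PolyTime inp (fun i => encUnary (y i))) :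
    PolyTime inp (fun i => encUnary (x i + y i)) := by
  simpa using unary_length (append hx hy)

theorem unary_mul {x y : ι → ℕ} (hx : PolyTime inp (fun i => encUnary (x i)))
    (hy : PolyTime inp (fun i => encUnary (y i))) :
    PolyTime inp (fun i => encUnary (x i * y i)) := by
  have := unary_length (flatMap (α := fun _ => ℕ) (l := fun i => List.replicate (x i) 0)
    (e := fun _ _ => .nat 0) (g := fun i _ => List.replicate (y i) (.nat 0))
    (by simpa [encUnary] using hx) (hy.lift Sigma.fst))
  simpa using this

theorem unary_const (n : ℕ) : PolyTime inp (fun _ => encUnary n) := by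
  induction n with
  | zero => exact nil
  | succ n ih => exact cons (natConst 0) ih

theorem nat_of_unary {n : ι → ℕ} (hn : PolyTime inp (fun i => encUnary (n i))) :
    PolyTime inp (fun i => .nat (n i)) := by
  simpa using length hn

end PolyTime

/-! ### Edge-disjoint paths and cuts -/

namespace STCut

variable {J : STCut}

theorem Feasible.card_lt {F : Finset (Fin J.m)} (hF : J.Feasible F) {κ : Type*} [Fintype κ]
    (P : κ → List (Fin J.m)) (hP : ∀ i, J.IsSTPath (P i) ∧ ∀ e ∈ P i, e ∉ F)
    (hd : ∀ i j, i ≠ j → List.Disjoint (P i) (P j)) : Fintype.card κ < J.k :=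
  hF _ (fun i => P ((Fintype.equivFin κ).symm i)) (fun i => hP _)
    (fun i j hij => hd _ _ (by simpa using hij))

theorem isSTPath_two {x y : Fin J.m} {a : Fin J.n} (hx : J.Joins x J.s a) (hy : J.Joins y a J.t)
    (hs : a ≠ J.s) (ht : a ≠ J.t) : J.IsSTPath [x, y] :=
  ⟨[J.s, a, J.t], .cons hx (.cons hy (.nil _)), by
    simp [hs.symm, ht, J.s_ne_t]⟩

theorem isSTPath_three {x y z : Fin J.m} {a b : Fin J.n} (hx : J.Joins x J.s a)
    (hy : J.Joins y a b) (hz : J.Joins z b J.t) (hab : a ≠ b) (hs : a ≠ J.s) (ht : a ≠ J.t)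
    (hs' : b ≠ J.s) (ht' : b ≠ J.t) : J.IsSTPath [x, y, z] :=
  ⟨[J.s, a, b, J.t], .cons hx (.cons hy (.cons hz (.nil _))), by
    simp [hs.symm, hs'.symm, ht, ht', hab, J.s_ne_t]⟩

theorem IsWalk.exists_crossing {u v : Fin J.n} {vs : List (Fin J.n)} {es : List (Fin J.m)}
    (h : J.IsWalk u vs es v) (X : Set (Fin J.n)) (hu : u ∈ X) (hv : v ∉ X) :
    ∃ e ∈ es, ¬((J.edge e).1 ∈ X ↔ (J.edge e).2.1 ∈ X) := by
  induction h with
  | nil => exact absurd hu hv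
  | @cons e u w v vs es hj _ ih =>
    by_cases hw : w ∈ X
    · obtain ⟨e', he', hc⟩ := ih hw hv
      exact ⟨e', List.mem_cons_of_mem _ he', hc⟩
    · refine ⟨e, List.mem_cons_self, ?_⟩
      rcases hj with ⟨h₁, h₂⟩ | ⟨h₁, h₂⟩ <;> rw [h₁, h₂] <;> tauto

/-- The easy direction of Menger: each path surviving `F` crosses the boundary of `X` in an edge of
`D`, and disjoint paths use different ones. -/
theorem feasible_of_cut {F D : Finset (Fin J.m)} (X : Set (Fin J.n)) (hs : J.s ∈ X)
    (ht : J.t ∉ X) (hD : ∀ e ∉ F, ¬((J.edge e).1 ∈ X ↔ (J.edge e).2.1 ∈ X) → e ∈ D)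
    (hk : D.card < J.k) : J.Feasible F := by
  intro r P hP hdisj
  have h : ∀ i, ∃ e ∈ P i, e ∈ D := by
    intro i
    obtain ⟨⟨vs, hw, -⟩, hF⟩ := hP i
    obtain ⟨e, he, hc⟩ := hw.exists_crossing X hs ht
    exact ⟨e, he, hD e (hF e he) hc⟩
  choose c hc hcD using h
  have hinj : Function.Injective c := by
    intro i j hij
    by_contra hne
    exact hdisj i j hne (hc i) (hij ▸ hc j)
  calc r = Fintype.card (Fin r) := (Fintype.card_fin r).symm
    _ = (Finset.univ.image c).card := by
      rw [Finset.card_image_of_injective _ hinj, Finset.card_univ]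
    _ ≤ D.card := Finset.card_le_card (by
      intro e he
      obtain ⟨i, -, rfl⟩ := Finset.mem_image.1 he
      exact hcD i)
    _ < J.k := hk

end STCut

/-! ### The reduction -/

/-- The edges of the `k`-route cut instance built from a bipartite graph with sides of sizes
`nU`, `nV` and with `m` edges. Only the edges `cheap v w`, which join `v` to the sink, are
affordable. The others join the source to `u` (`src u`) and, for an edge `e = (u, v)`, form
the path through source, `v`, `u`, sink (`sv e`, `vu e`, `ut e`). -/
inductive Gadget (nU nV W m : ℕ) where
  | cheap (v : Fin nV) (w : Fin W)
  | src (u : Fin nU)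
  | sv (e : Fin m)
  | vu (e : Fin m)
  | ut (e : Fin m)

namespace SSVE

variable (I : SSVE)

/-- The number of parallel affordable edges at each vertex of the side `V`. -/
def mult : ℕ := I.n ^ 3 + 1

/-- The cost of the edges that are not affordable. -/
def bigCost : ℕ := I.nV * I.mult

abbrev G : Type := Gadget I.nU I.nV I.mult I.m

def edgeAt (e : Fin I.m) : Fin I.nU × Fin I.nV := I.edges.get e

def uId (u : Fin I.nU) : Fin (I.n + 2) := ⟨u, by have := u.2; simp only [n]; omega⟩

def vId (v : Fin I.nV) : Fin (I.n + 2) := ⟨I.nU + v, by have := v.2; simp only [n]; omega⟩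

def sId : Fin (I.n + 2) := ⟨I.n, by omega⟩

def tId : Fin (I.n + 2) := ⟨I.n + 1, by omega⟩

/-- End points and cost of an edge of the reduction. -/
def desc : I.G → Fin (I.n + 2) × Fin (I.n + 2) × ℚ≥0
  | .cheap v _ => (I.tId, I.vId v, ((1 : ℕ) : ℚ≥0))
  | .src u => (I.sId, I.uId u, (I.bigCost : ℚ≥0))
  | .sv e => (I.sId, I.vId (I.edgeAt e).2, (I.bigCost : ℚ≥0))
  | .vu e => (I.vId (I.edgeAt e).2, I.uId (I.edgeAt e).1, (I.bigCost : ℚ≥0))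
  | .ut e => (I.uId (I.edgeAt e).1, I.tId, (I.bigCost : ℚ≥0))

def gadgets : List I.G :=
  ((List.finRange I.nV).flatMap fun v => (List.finRange I.mult).map fun w => Gadget.cheap v w) ++
    ((List.finRange I.nU).map Gadget.src ++ ((List.finRange I.m).map Gadget.sv ++
      ((List.finRange I.m).map Gadget.vu ++ (List.finRange I.m).map Gadget.ut)))

/-- The least size of a feasible set. -/
def minCard : ℕ := (I.α.num * I.nU + (I.α.den - 1)) / I.α.den

theorem uId_ne_sId (u : Fin I.nU) : I.uId u ≠ I.sId := by
  have := u.2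
  have hn : I.n = I.nU + I.nV := rfl
  simp only [uId, sId, ne_eq, Fin.mk.injEq]
  omega

theorem uId_ne_tId (u : Fin I.nU) : I.uId u ≠ I.tId := by
  have := u.2
  have hn : I.n = I.nU + I.nV := rfl
  simp only [uId, tId, ne_eq, Fin.mk.injEq]
  omega

theorem vId_ne_sId (v : Fin I.nV) : I.vId v ≠ I.sId := by
  have := v.2
  have hn : I.n = I.nU + I.nV := rfl
  simp only [vId, sId, ne_eq, Fin.mk.injEq]
  omega

theorem vId_ne_tId (v : Fin I.nV) : I.vId v ≠ I.tId := by
  have := v.2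
  have hn : I.n = I.nU + I.nV := rfl
  simp only [vId, tId, ne_eq, Fin.mk.injEq]
  omega

theorem vId_ne_uId (v : Fin I.nV) (u : Fin I.nU) : I.vId v ≠ I.uId u := by
  have := u.2; simp only [vId, uId, ne_eq, Fin.mk.injEq]; omega

theorem sId_ne_tId : I.sId ≠ I.tId := by simp [sId, tId]

theorem uId_inj {u u' : Fin I.nU} : I.uId u = I.uId u' ↔ u = u' := by
  simp [uId, Fin.ext_iff]

theorem vId_inj {v v' : Fin I.nV} : I.vId v = I.vId v' ↔ v = v' := by
  simp [vId, Fin.ext_iff]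

/-- The `k`-route cut instance. -/
def toSTCut : STCut where
  n := I.n + 2
  edges := I.gadgets.map I.desc
  loopless := by
    intro e he
    obtain ⟨x, -, rfl⟩ := List.mem_map.1 he
    cases x
    · exact (I.vId_ne_tId _).symm
    · exact (I.uId_ne_sId _).symm
    · exact (I.vId_ne_sId _).symm
    · exact I.vId_ne_uId _ _
    · exact I.uId_ne_tId _
  s := I.sId
  t := I.tId
  s_ne_t := I.sId_ne_tId
  k := I.m + (I.nU - I.minCard) + 1
  one_le_k := by omega

theorem gadgets_nodup : I.gadgets.Nodup := by
  have inj : ∀ {α β : Type} {f : α → β} {l : List α}, Function.Injective f → l.Nodup →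
      (l.map f).Nodup := fun hf hl => hl.map hf
  have fr := fun n => List.nodup_finRange n
  refine List.Nodup.append ?_ (List.Nodup.append (inj (fun _ _ h => by simpa using h) (fr _))
    (List.Nodup.append (inj (fun _ _ h => by simpa using h) (fr _))
    (List.Nodup.append (inj (fun _ _ h => by simpa using h) (fr _))
      (inj (fun _ _ h => by simpa using h) (fr _)) ?_) ?_) ?_) ?_
  · rw [List.nodup_flatMap]
    refine ⟨fun v _ => inj (fun _ _ h => by simpa using h) (fr _), ?_⟩
    refine (fr I.nV).imp ?_
    intro a b hab
    simp only [Function.onFun, List.disjoint_left]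
    rintro x hx hx'
    obtain ⟨w, -, rfl⟩ := List.mem_map.1 hx
    obtain ⟨w', -, h⟩ := List.mem_map.1 hx'
    simp only [Gadget.cheap.injEq] at h
    exact hab h.1.symm
  all_goals
    rw [List.disjoint_left]
    intro x hx hx'
    cases x <;> simp at hx hx'

theorem mem_gadgets (x : I.G) : x ∈ I.gadgets := by
  cases x <;> simp [gadgets]

theorem m_toSTCut : I.toSTCut.m = I.gadgets.length := by
  simp [STCut.m, toSTCut]

/-- The edges of the instance, numbered. -/
noncomputable def idx : Fin I.toSTCut.m ≃ I.G :=
  letI := Classical.decEq I.G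
  (finCongr I.m_toSTCut).trans
    (I.gadgets_nodup.getEquivOfForallMemList _ I.mem_gadgets)

/-- The numbering follows the order of the list, so that the characteristic vector of an edge set
can be read in parallel with the list of gadgets. -/
theorem idx_apply (i : Fin I.toSTCut.m) : I.idx i = I.gadgets.get (i.cast I.m_toSTCut) := rfl

theorem edge_toSTCut (i : Fin I.toSTCut.m) : I.toSTCut.edge i = I.desc (I.idx i) := by
  exact List.getElem_map I.desc

theorem edge_idx_symm (x : I.G) : I.toSTCut.edge (I.idx.symm x) = I.desc x := by
  rw [edge_toSTCut, Equiv.apply_symm_apply]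

/-- How much an edge counts towards the vertex `v`. -/
def weight (v : Fin I.nV) : I.G → ℕ
  | .cheap v' _ => if v' = v then 1 else 0
  | _ => I.mult + 1

/-- If only cheap edges are deleted, this is the number deleted at `v`. A single expensive edge
lifts every load above `mult`, which makes `fromCut` all of `U` without a case distinction in the
algorithm. -/
noncomputable def load (F : Finset (Fin I.toSTCut.m)) (v : Fin I.nV) : ℕ :=
  ∑ x ∈ F, I.weight v (I.idx x)

/-- The set of vertices with all neighbours (almost) separated from the sink. -/
noncomputable def fromCut (F : Finset (Fin I.toSTCut.m)) : Finset (Fin I.nU) :=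
  Finset.univ.filter fun u =>
    ∀ e : Fin I.m, (I.edgeAt e).1 = u → I.mult < I.nU + I.load F (I.edgeAt e).2

theorem feasible_iff {S : Finset (Fin I.nU)} : I.Feasible S ↔ I.minCard ≤ S.card := by
  have hd := I.α.den_pos
  rw [Feasible, minCard, ← Nat.lt_succ_iff, Nat.div_lt_iff_lt_mul hd]
  have h : I.α = (I.α.num : ℚ≥0) / I.α.den := (NNRat.num_div_den _).symm
  have hd' : (0 : ℚ≥0) < I.α.den := by exact_mod_cast hd
  conv_lhs => rw [h, div_mul_eq_mul_div, div_le_iff₀ hd']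
  norm_cast
  rw [Nat.succ_mul]
  omega

theorem minCard_le : I.minCard ≤ I.nU := by
  have := (I.feasible_iff (S := Finset.univ)).1 (by
    rw [Feasible, Finset.card_univ, Fintype.card_fin]
    exact mul_le_of_le_one_left (by simp) I.α_le_one)
  simpa using this

theorem exists_edgeAt {u : Fin I.nU} {v : Fin I.nV} :
    (u, v) ∈ I.edges ↔ ∃ e, I.edgeAt e = (u, v) := by
  rw [List.mem_iff_get]
  rfl

theorem mem_nbrs {S : Finset (Fin I.nU)} {v : Fin I.nV} :
    v ∈ I.nbrs S ↔ ∃ e, (I.edgeAt e).1 ∈ S ∧ (I.edgeAt e).2 = v := by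
  simp only [nbrs, Finset.mem_filter, Finset.mem_univ, true_and, exists_edgeAt]
  constructor
  · rintro ⟨u, hu, e, he⟩
    exact ⟨e, by rw [he]; exact hu, by rw [he]⟩
  · rintro ⟨e, he, rfl⟩
    exact ⟨_, he, e, rfl⟩

/-! From feasible sets to cuts. -/

open Classical in
noncomputable def toCut (S : Finset (Fin I.nU)) : Finset (Fin I.toSTCut.m) :=
  ((I.nbrs S ×ˢ (Finset.univ : Finset (Fin I.mult))).image
    fun p => I.idx.symm (Gadget.cheap p.1 p.2))

theorem cost_toCut (S : Finset (Fin I.nU)) :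
    I.toSTCut.cost (I.toCut S) = (I.value S : ℚ≥0) * (I.mult : ℚ≥0) := by
  classical
  rw [STCut.cost, toCut, Finset.sum_image]
  · simp only [edge_idx_symm, desc]
    simp [value]
  · rintro ⟨v, w⟩ _ ⟨v', w'⟩ _ h
    simpa using h

theorem feasible_toCut {S : Finset (Fin I.nU)} (hS : I.Feasible S) :
    I.toSTCut.Feasible (I.toCut S) := by
  classical
  rw [feasible_iff] at hS
  let X : Set (Fin (I.n + 2)) :=
    {x | x = I.sId ∨ (∃ u ∈ S, x = I.uId u) ∨ ∃ v ∈ I.nbrs S, x = I.vId v}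
  have hXs : I.sId ∈ X := Or.inl rfl
  have hXt : I.tId ∉ X := by
    rintro (h | ⟨u, -, h⟩ | ⟨v, -, h⟩)
    · exact I.sId_ne_tId h.symm
    · exact I.uId_ne_tId u h.symm
    · exact I.vId_ne_tId v h.symm
  have hXu : ∀ u, I.uId u ∈ X ↔ u ∈ S := by
    intro u
    constructor
    · rintro (h | ⟨u', hu, h⟩ | ⟨v, -, h⟩)
      · exact absurd h (I.uId_ne_sId u)
      · rw [I.uId_inj] at h; exact h ▸ hu
      · exact absurd h.symm (I.vId_ne_uId v u)
    · exact fun h => Or.inr (Or.inl ⟨u, h, rfl⟩)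
  have hXv : ∀ v, I.vId v ∈ X ↔ v ∈ I.nbrs S := by
    intro v
    constructor
    · rintro (h | ⟨u', hu, h⟩ | ⟨v', hv, h⟩)
      · exact absurd h (I.vId_ne_sId v)
      · exact absurd h (I.vId_ne_uId v u')
      · rw [I.vId_inj] at h; exact h ▸ hv
    · exact fun h => Or.inr (Or.inr ⟨v, h, rfl⟩)
  -- The one edge of the private path of `e` that crosses the boundary of `X`. The combination `u ∈
  -- S`, `v ∉ Γ(S)` cannot occur.
  let cr : Fin I.m → I.G := fun e => if (I.edgeAt e).1 ∈ S then .ut e else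
    if (I.edgeAt e).2 ∈ I.nbrs S then .vu e else .sv e
  let D : Finset (Fin I.toSTCut.m) :=
    (Finset.univ.image fun e => I.idx.symm (cr e)) ∪ (Sᶜ.image fun u => I.idx.symm (.src u))
  refine STCut.feasible_of_cut (D := D) X hXs hXt ?_ ?_
  · intro i hi hc
    obtain ⟨x, rfl⟩ := I.idx.symm.surjective i
    rw [edge_idx_symm] at hc
    change ¬((I.desc x).1 ∈ X ↔ (I.desc x).2.1 ∈ X) at hc
    have hnb : ∀ e, (I.edgeAt e).1 ∈ S → (I.edgeAt e).2 ∈ I.nbrs S :=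
      fun e he => I.mem_nbrs.2 ⟨e, he, rfl⟩
    have hcr : ∀ e x, cr e = x → I.idx.symm x ∈ D := fun e x h =>
      Finset.mem_union_left _ (Finset.mem_image.2 ⟨e, Finset.mem_univ _, by rw [h]⟩)
    cases x with
    | cheap v w =>
      simp only [desc, hXt, hXv, false_iff, not_not] at hc
      exact absurd (Finset.mem_image.2 ⟨(v, w), by simpa using hc, rfl⟩) hi
    | src u =>
      simp only [desc, hXs, hXu, true_iff] at hc
      exact Finset.mem_union_right _ (Finset.mem_image.2 ⟨u, by simpa using hc, rfl⟩)
    | sv e =>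
      simp only [desc, hXs, hXv, true_iff] at hc
      have := hnb e
      exact hcr e _ (by simp only [cr]; rw [if_neg (by tauto), if_neg hc])
    | vu e =>
      simp only [desc, hXu, hXv] at hc
      have := hnb e
      exact hcr e _ (by simp only [cr]; rw [if_neg (by tauto), if_pos (by tauto)])
    | ut e =>
      simp only [desc, hXu, hXt, iff_false, not_not] at hc
      exact hcr e _ (by simp only [cr]; rw [if_pos hc])
  · have h₁ : D.card ≤ I.m + Sᶜ.card := by
      refine (Finset.card_union_le _ _).trans (add_le_add ?_ Finset.card_image_le)
      exact Finset.card_image_le.trans (by simp)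
    rw [Finset.card_compl, Fintype.card_fin] at h₁
    change _ < I.m + (I.nU - I.minCard) + 1
    omega

/-! From cuts to feasible sets. -/

variable {I} in
theorem load_of_big {F : Finset (Fin I.toSTCut.m)} {x : I.G} (hx : I.idx.symm x ∈ F)
    (hw : ∀ v, I.weight v x = I.mult + 1) (v : Fin I.nV) : I.mult < I.nU + I.load F v := by
  have : I.weight v (I.idx (I.idx.symm x)) ≤ I.load F v :=
    Finset.single_le_sum (f := fun x => I.weight v (I.idx x)) (by simp) hx
  rw [Equiv.apply_symm_apply, hw] at this
  omega

/-- The edge is not affordable. -/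
def IsBig (x : I.G) : Prop := ∀ v w, x ≠ Gadget.cheap v w

variable {I} in
theorem IsBig.weight {x : I.G} (h : I.IsBig x) (v : Fin I.nV) : I.weight v x = I.mult + 1 := by
  cases x with
  | cheap v w => exact absurd rfl (h v w)
  | _ => rfl

variable {I} in
theorem IsBig.cost {x : I.G} (h : I.IsBig x) : (I.desc x).2.2 = I.bigCost := by
  cases x with
  | cheap v w => exact absurd rfl (h v w)
  | _ => rfl

/-- With an expensive edge the cost is at least `nV * mult`, enough for any neighbourhood. Otherwise
the loads add up to the cost, and each neighbour of the set has load greater than `mult - nU`;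
summing over the neighbours loses at most `nU * nV`. -/
theorem value_fromCut_le (F : Finset (Fin I.toSTCut.m)) :
    (I.value (I.fromCut F) : ℚ≥0) * I.mult ≤ I.toSTCut.cost F + I.nU * I.nV := by
  classical
  by_cases hbig : ∃ x, I.IsBig x ∧ I.idx.symm x ∈ F
  · obtain ⟨x, hx, hxF⟩ := hbig
    have h₁ : (I.bigCost : ℚ≥0) ≤ I.toSTCut.cost F := by
      rw [← hx.cost, ← edge_idx_symm, STCut.cost]
      exact Finset.single_le_sum (f := fun e => (I.toSTCut.edge e).2.2) (by simp) hxF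
    have h₂ : I.value (I.fromCut F) ≤ I.nV := by
      simpa [value] using Finset.card_le_univ (I.nbrs (I.fromCut F))
    calc (I.value (I.fromCut F) : ℚ≥0) * I.mult ≤ I.nV * I.mult := by gcongr
      _ = I.bigCost := by simp [bigCost]
      _ ≤ _ := h₁.trans (by simp)
  · have hch : ∀ i ∈ F, ∃ v w, I.idx i = .cheap v w := by
      intro i hi
      by_contra h
      exact hbig ⟨I.idx i, fun v w hvw => h ⟨v, w, hvw⟩, by simpa using hi⟩
    have hcost : I.toSTCut.cost F = (F.card : ℚ≥0) := by
      rw [STCut.cost, Finset.card_eq_sum_ones, Nat.cast_sum]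
      refine Finset.sum_congr rfl fun i hi => ?_
      obtain ⟨v, w, h⟩ := hch i hi
      rw [edge_toSTCut, h]
      rfl
    have hsum : ∑ v, I.load F v = F.card := by
      simp only [load]
      rw [Finset.sum_comm, Finset.card_eq_sum_ones]
      refine Finset.sum_congr rfl fun i hi => ?_
      obtain ⟨v, w, h⟩ := hch i hi
      simp [h, weight]
    let T : Finset (Fin I.nV) := Finset.univ.filter fun v => I.mult < I.nU + I.load F v
    have hsub : I.nbrs (I.fromCut F) ⊆ T := by
      intro v hv
      obtain ⟨e, he, rfl⟩ := I.mem_nbrs.1 hv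
      simp only [fromCut, Finset.mem_filter, Finset.mem_univ, true_and] at he
      exact Finset.mem_filter.2 ⟨Finset.mem_univ _, he e rfl⟩
    have h₁ : T.card * I.mult ≤ I.nV * I.nU + F.card := by
      calc T.card * I.mult = ∑ v ∈ T, I.mult := by simp
        _ ≤ ∑ v ∈ T, (I.nU + I.load F v) :=
          Finset.sum_le_sum fun v hv => (Finset.mem_filter.1 hv).2.le
        _ ≤ ∑ v, (I.nU + I.load F v) :=
          Finset.sum_le_sum_of_subset (Finset.subset_univ _)
        _ = I.nV * I.nU + F.card := by simp [Finset.sum_add_distrib, hsum]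
    have h₂ : I.value (I.fromCut F) ≤ T.card := Finset.card_le_card hsub
    have h₃ : I.value (I.fromCut F) * I.mult ≤ F.card + I.nU * I.nV := by
      calc _ ≤ T.card * I.mult := by gcongr
        _ ≤ _ := by rw [mul_comm I.nU]; omega
    rw [hcost]
    exact_mod_cast h₃

theorem joins_of {x : I.G} {a b : Fin (I.n + 2)}
    (h : ((I.desc x).1 = a ∧ (I.desc x).2.1 = b) ∨ ((I.desc x).1 = b ∧ (I.desc x).2.1 = a)) :
    I.toSTCut.Joins (I.idx.symm x) a b := by
  unfold STCut.Joins
  rw [edge_idx_symm]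
  exact h

/-- Each deleted cheap edge at `v` contributes 1 to the load, so at least `nU` survive; distinct `u`
can be given distinct ones. -/
theorem exists_free {F : Finset (Fin I.toSTCut.m)} {v : Fin I.nV}
    (hv : I.nU + I.load F v ≤ I.mult) : ∃ φ : Fin I.nU → Fin I.mult, Function.Injective φ ∧
      ∀ u, I.idx.symm (.cheap v (φ u)) ∉ F := by
  classical
  let used : Finset (Fin I.mult) := Finset.univ.filter fun w => I.idx.symm (.cheap v w) ∈ F
  have h₁ : used.card ≤ I.load F v := by
    have hinj : ∀ w w', I.idx.symm (.cheap v w) = I.idx.symm (.cheap v w') → w = w' := by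
      intro w w' h
      simpa using h
    calc used.card = ∑ x ∈ used.image fun w => I.idx.symm (.cheap v w),
          I.weight v (I.idx x) := by
            rw [Finset.sum_image fun w _ w' _ h => hinj w w' h]
            simp [weight]
      _ ≤ I.load F v := Finset.sum_le_sum_of_subset (by
            intro x hx
            obtain ⟨w, hw, rfl⟩ := Finset.mem_image.1 hx
            exact (Finset.mem_filter.1 hw).2)
  have h₂ : Fintype.card (Fin I.nU) ≤ Fintype.card {w // w ∉ used} := by
    rw [Fintype.card_subtype_compl, Fintype.card_fin, Fintype.card_fin]
    simp only [Fintype.card_coe]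
    omega
  obtain ⟨φ⟩ := Function.Embedding.nonempty_of_card_le h₂
  refine ⟨fun u => (φ u).1, fun u u' h => φ.injective (Subtype.ext h), fun u hu => ?_⟩
  exact (φ u).2 (Finset.mem_filter.2 ⟨Finset.mem_univ _, hu⟩)

/-- If too few vertices were selected, each unselected `u` would contribute one disjoint path beyond
the `m` private ones, giving at least `k` paths that avoid the cut. -/
theorem feasible_fromCut {F : Finset (Fin I.toSTCut.m)} (hF : I.toSTCut.Feasible F) :
    I.Feasible (I.fromCut F) := by
  classical
  by_cases hbig : ∃ x, I.IsBig x ∧ I.idx.symm x ∈ F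
  · obtain ⟨x, hx, hxF⟩ := hbig
    have : I.fromCut F = Finset.univ := by
      ext u
      simp only [fromCut, Finset.mem_filter, Finset.mem_univ, true_and, iff_true]
      exact fun e _ => load_of_big hxF hx.weight _
    rw [this, feasible_iff]
    simpa using I.minCard_le
  rw [feasible_iff]
  by_contra hlt
  have hbig' : ∀ x, I.IsBig x → I.idx.symm x ∉ F := fun x hx h => hbig ⟨x, hx, h⟩
  have hch : ∀ u : {u // u ∉ I.fromCut F}, ∃ e, (I.edgeAt e).1 = u ∧
      I.nU + I.load F (I.edgeAt e).2 ≤ I.mult := by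
    rintro ⟨u, hu⟩
    simp only [fromCut, Finset.mem_filter, Finset.mem_univ, true_and] at hu
    push Not at hu
    exact hu
  choose ch hch₁ hch₂ using hch
  -- The condition on the load is moved inside so that `φ` can be chosen for all `v`; at overloaded
  -- vertices its value is arbitrary, and `0` exists because `mult` is positive.
  have hfree : ∀ v, ∃ φ : Fin I.nU → Fin I.mult, I.nU + I.load F v ≤ I.mult →
      Function.Injective φ ∧ ∀ u, I.idx.symm (.cheap v (φ u)) ∉ F := by
    intro v
    by_cases hv : I.nU + I.load F v ≤ I.mult
    · obtain ⟨φ, hφ⟩ := I.exists_free hv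
      exact ⟨φ, fun _ => hφ⟩
    · exact ⟨fun _ => ⟨0, by simp [mult]⟩, fun h => absurd h hv⟩
  choose φ hφ using hfree
  -- A chosen edge `ch u` sends its own path from `v` straight to the sink by a free cheap edge, and
  -- so leaves its edge `ut` to the extra path through `u`.
  let P : Fin I.m ⊕ {u // u ∉ I.fromCut F} → List I.G := Sum.elim
    (fun e => if ∃ u, ch u = e then
      [.sv e, .cheap (I.edgeAt e).2 (φ (I.edgeAt e).2 (I.edgeAt e).1)] else [.sv e, .vu e, .ut e])
    (fun u => [.src u, .ut (ch u)])
  have hPdisj : ∀ i j, i ≠ j → List.Disjoint (P i) (P j) := by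
    have hll : ∀ e e', e ≠ e' → List.Disjoint (P (.inl e)) (P (.inl e')) := by
      intro e e' hne
      -- Chosen edges with the same `v` come from different `u`, so injectivity of `φ` at `v` keeps
      -- their cheap edges apart.
      have hcc : ∀ u u', ch u = e → ch u' = e' → (I.edgeAt e).2 = (I.edgeAt e').2 →
          φ (I.edgeAt e).2 (I.edgeAt e).1 ≠ φ (I.edgeAt e').2 (I.edgeAt e').1 := by
        rintro u u' rfl rfl h₂ h
        rw [← h₂] at h
        have h₁ := (hφ _ (hch₂ u)).1 h
        rw [hch₁, hch₁] at h₁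
        exact hne (by rw [Subtype.ext h₁])
      simp only [P, Sum.elim_inl]
      split_ifs with h h' h'
      · obtain ⟨u, hu⟩ := h
        obtain ⟨u', hu'⟩ := h'
        simpa [List.disjoint_left, hne] using hcc u u' hu hu'
      all_goals simp [List.disjoint_left, hne]
    have hlr : ∀ e u, List.Disjoint (P (.inl e)) (P (.inr u)) := by
      intro e u
      simp only [P, Sum.elim_inl, Sum.elim_inr]
      split_ifs with h
      · simp [List.disjoint_left]
      · simp only [List.disjoint_left]
        intro x hx hx'
        simp only [List.mem_cons, List.not_mem_nil, or_false] at hx hx'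
        rcases hx with rfl | rfl | rfl <;> simp at hx'
        -- The only possible common edge is `ut e` with `e = ch u`, but then `e` would have been
        -- rerouted.
        exact h ⟨u, hx'.symm⟩
    rintro (e | u) (e' | u') hne
    · exact hll e e' (by simpa using hne)
    · exact hlr e u'
    · exact (hlr e' u).symm
    · have huu : u ≠ u' := by simpa using hne
      have hcu : ch u ≠ ch u' := by
        intro h
        have := hch₁ u
        rw [h, hch₁] at this
        exact huu (Subtype.ext this.symm)
      have huu' : u.1 ≠ u'.1 := fun h => huu (Subtype.ext h)
      simp [P, List.disjoint_left, hcu, huu']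
  have hPpath : ∀ i, I.toSTCut.IsSTPath ((P i).map I.idx.symm) ∧
      ∀ x ∈ P i, I.idx.symm x ∉ F := by
    rintro (e | u)
    · simp only [P, Sum.elim_inl]
      split_ifs with h
      · obtain ⟨u, rfl⟩ := h
        refine ⟨STCut.isSTPath_two (a := I.vId (I.edgeAt (ch u)).2)
          (I.joins_of (Or.inl ⟨rfl, rfl⟩)) (I.joins_of (Or.inr ⟨rfl, rfl⟩)) (I.vId_ne_sId _)
          (I.vId_ne_tId _), ?_⟩
        intro x hx
        simp only [List.mem_cons, List.not_mem_nil, or_false] at hx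
        rcases hx with rfl | rfl
        · exact hbig' _ (by simp [IsBig])
        · exact (hφ _ (hch₂ u)).2 _
      · refine ⟨STCut.isSTPath_three (a := I.vId (I.edgeAt e).2) (b := I.uId (I.edgeAt e).1)
          (I.joins_of (Or.inl ⟨rfl, rfl⟩)) (I.joins_of (Or.inl ⟨rfl, rfl⟩))
          (I.joins_of (Or.inl ⟨rfl, rfl⟩)) (I.vId_ne_uId _ _) (I.vId_ne_sId _)
          (I.vId_ne_tId _) (I.uId_ne_sId _) (I.uId_ne_tId _), ?_⟩
        intro x hx
        simp only [List.mem_cons, List.not_mem_nil, or_false] at hx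
        rcases hx with rfl | rfl | rfl <;> exact hbig' _ (by simp [IsBig])
    · refine ⟨STCut.isSTPath_two (a := I.uId u) (I.joins_of (Or.inl ⟨rfl, rfl⟩))
          (I.joins_of (Or.inl ⟨congrArg I.uId (hch₁ u), rfl⟩)) (I.uId_ne_sId _)
          (I.uId_ne_tId _), ?_⟩
      intro x hx
      simp only [P, Sum.elim_inr, List.mem_cons, List.not_mem_nil, or_false] at hx
      rcases hx with rfl | rfl <;> exact hbig' _ (by simp [IsBig])
  have hcard := hF.card_lt (fun i => (P i).map I.idx.symm)
    (fun i => ⟨(hPpath i).1, fun e he => by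
      obtain ⟨x, hx, rfl⟩ := List.mem_map.1 he
      exact (hPpath i).2 x hx⟩)
    (fun i j hij => List.disjoint_map I.idx.symm.injective (hPdisj i j hij))
  rw [Fintype.card_sum, Fintype.card_subtype_compl, Fintype.card_fin, Fintype.card_fin,
    Fintype.card_coe] at hcard
  have h₁ := I.minCard_le
  have h₂ : I.toSTCut.k = I.m + (I.nU - I.minCard) + 1 := rfl
  omega

end SSVE

theorem encSet_eq {n : ℕ} (S : Finset (Fin n)) :
    encSet S = encList ((List.finRange n).map fun i => .nat (if i ∈ S then 1 else 0)) := by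
  rw [encSet, List.ofFn_eq_map]
  congr 2
  funext i
  split_ifs <;> rfl

theorem encRat_natCast (n : ℕ) : encRat (n : ℚ≥0) = .pair (.nat n) (.nat 1) := by
  simp [encRat]

namespace SSVE

/-! ### The reduction is computable in polynomial time -/

theorem polyTime_nU : PolyTime enc (fun I => encUnary I.nU) := (PolyTime.refl enc).fst

theorem polyTime_nV : PolyTime enc (fun I => encUnary I.nV) := (PolyTime.refl enc).snd.fst

theorem polyTime_n : PolyTime enc (fun I => encUnary I.n) :=
  PolyTime.unary_add polyTime_nU polyTime_nV

def encEdge (I : SSVE) (e : Fin I.m) : Data :=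
  .pair (.nat (I.edgeAt e).1) (.nat (I.edgeAt e).2)

theorem polyTime_edges :
    PolyTime enc (fun I => encList ((List.finRange I.m).map I.encEdge)) := by
  refine PolyTime.congr_out (PolyTime.refl enc).snd.snd.fst fun I => ?_
  congr 1
  refine List.ext_getElem (by rw [List.length_map, List.length_map, List.length_finRange]; rfl)
    fun j _ _ => ?_
  rw [List.getElem_map, List.getElem_map, List.getElem_finRange]
  rfl

theorem polyTime_m : PolyTime enc (fun I => .nat I.m) := by
  simpa using PolyTime.length polyTime_edges

theorem polyTime_mult : PolyTime enc (fun I => encUnary I.mult) := by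
  have h := PolyTime.unary_add (PolyTime.unary_mul (PolyTime.unary_mul polyTime_n polyTime_n)
    polyTime_n) (PolyTime.unary_const 1)
  exact h.congr_out fun I => by rw [mult, pow_succ, pow_two]

theorem polyTime_minCard : PolyTime enc (fun I => .nat I.minCard) := by
  have h := (PolyTime.refl enc).snd.snd.snd
  exact ((h.fst.mul (PolyTime.nat_of_unary polyTime_nU)).add
    (h.snd.sub (PolyTime.natConst 1))).div h.snd

/-- The data of a cheap edge may depend on `v` only, not on its parallel index; this holds both for
its description and for its tag. -/
theorem polyTime_gadgets {d : ∀ I : SSVE, I.G → Data} {dc : ∀ I : SSVE, Fin I.nV → Data}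
    (hdc : ∀ I v w, d I (.cheap v w) = dc I v)
    (hc : PolyTime (fun p : (I : SSVE) × Fin I.nV => .pair p.1.enc (.nat p.2.1))
      (fun p => dc p.1 p.2))
    (hsrc : PolyTime (fun p : (I : SSVE) × Fin I.nU => .pair p.1.enc (.nat p.2.1))
      (fun p => d p.1 (.src p.2)))
    (hsv : PolyTime (fun p : (I : SSVE) × Fin I.m => .pair p.1.enc (p.1.encEdge p.2))
      (fun p => d p.1 (.sv p.2)))
    (hvu : PolyTime (fun p : (I : SSVE) × Fin I.m => .pair p.1.enc (p.1.encEdge p.2))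
      (fun p => d p.1 (.vu p.2)))
    (hut : PolyTime (fun p : (I : SSVE) × Fin I.m => .pair p.1.enc (p.1.encEdge p.2))
      (fun p => d p.1 (.ut p.2))) :
    PolyTime enc (fun I => encList (I.gadgets.map (d I))) := by
  simp only [gadgets, List.map_append, List.map_map, List.map_flatMap, Function.comp_def, hdc]
  refine PolyTime.append (PolyTime.flatMap (PolyTime.finRange polyTime_nV) ?_)
    (PolyTime.append (PolyTime.map (PolyTime.finRange polyTime_nU) hsrc)
    (PolyTime.append (PolyTime.map polyTime_edges hsv)
    (PolyTime.append (PolyTime.map polyTime_edges hvu) (PolyTime.map polyTime_edges hut))))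
  refine PolyTime.map (ι := (I : SSVE) × Fin I.nV) (α := fun p => Fin p.1.mult)
    (l := fun p => List.finRange p.1.mult)
    ((PolyTime.finRange polyTime_mult).lift Sigma.fst) ?_
  exact hc.lift (κ := (p : (I : SSVE) × Fin I.nV) × Fin p.1.mult) Sigma.fst

theorem polyTime_toSTCut : PolyTime enc (fun I => I.toSTCut.enc) := by
  have hn := PolyTime.nat_of_unary polyTime_n
  have hn' := hn.add (PolyTime.natConst 1)
  have hnU := PolyTime.nat_of_unary polyTime_nU
  have hnV := PolyTime.nat_of_unary polyTime_nV
  have hbig : PolyTime enc (fun I => .pair (.nat I.bigCost) (.nat 1)) :=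
    (hnV.mul (PolyTime.nat_of_unary polyTime_mult)).pair (PolyTime.natConst 1)
  have hedges : PolyTime enc (fun I => encList (I.gadgets.map fun x =>
      .pair (.nat (I.desc x).1) (.pair (.nat (I.desc x).2.1) (encRat (I.desc x).2.2)))) := by
    refine polyTime_gadgets (dc := fun I v => .pair (.nat (I.n + 1)) (.pair (.nat (I.nU + v))
      (.pair (.nat 1) (.nat 1)))) ?_ ?_ ?_ ?_ ?_ ?_
    · intro I v w
      simp only [desc, encRat_natCast]
      rfl
    · exact (hn'.lift Sigma.fst).pair (((hnU.lift Sigma.fst).add (PolyTime.refl _).snd).pair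
        ((PolyTime.natConst 1).pair (PolyTime.natConst 1)))
    all_goals simp only [desc, encRat_natCast]
    · exact (hn.lift Sigma.fst).pair ((PolyTime.refl _).snd.pair (hbig.lift Sigma.fst))
    · exact (hn.lift Sigma.fst).pair (((hnU.lift Sigma.fst).add (PolyTime.refl _).snd.snd).pair
        (hbig.lift Sigma.fst))
    · exact ((hnU.lift Sigma.fst).add (PolyTime.refl _).snd.snd).pair
        ((PolyTime.refl _).snd.fst.pair (hbig.lift Sigma.fst))
    · exact (PolyTime.refl _).snd.fst.pair ((hn'.lift Sigma.fst).pair (hbig.lift Sigma.fst))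
  have hk := (polyTime_m.add (hnU.sub polyTime_minCard)).add (PolyTime.natConst 1)
  refine PolyTime.congr_out ((PolyTime.unary_add polyTime_n (PolyTime.unary_const 2)).pair
    (hedges.pair (hn.pair (hn'.pair hk)))) fun I => ?_
  simp only [STCut.enc, toSTCut, List.map_map]
  rfl

/-- Recognizes the vertex at which an affordable edge ends. -/
def tag (I : SSVE) : I.G → ℕ
  | .cheap v _ => v + 1
  | _ => 0

theorem weight_eq (I : SSVE) (v : Fin I.nV) (x : I.G) :
    I.weight v x = if I.tag x = 0 then I.mult + 1 else if I.tag x = v + 1 then 1 else 0 := by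
  cases x <;> simp [weight, tag, Fin.ext_iff]

theorem polyTime_tags : PolyTime enc (fun I =>
    encList ((List.finRange I.toSTCut.m).map fun i => .nat (I.tag (I.idx i)))) := by
  have h : PolyTime enc (fun I => encList (I.gadgets.map fun x => .nat (I.tag x))) :=
    polyTime_gadgets (dc := fun I v => .nat (v + 1)) (fun _ _ _ => rfl)
      ((PolyTime.refl _).snd.add (PolyTime.natConst 1)) (PolyTime.natConst 0)
      (PolyTime.natConst 0) (PolyTime.natConst 0) (PolyTime.natConst 0)
  refine h.congr_out fun I => ?_
  congr 1
  refine List.ext_getElem (by simp [m_toSTCut]) fun j _ _ => ?_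
  simp [idx_apply]

theorem polyTime_load : PolyTime (fun p : (x : (I : SSVE) × Finset (Fin I.toSTCut.m)) × Fin x.1.nV =>
      .pair (.pair p.1.1.enc (encSet p.1.2)) (.nat p.2.1))
    (fun p => .nat (p.1.1.load p.1.2 p.2)) := by
  have hz : PolyTime (fun x : (I : SSVE) × Finset (Fin I.toSTCut.m) => .pair x.1.enc (encSet x.2))
      (fun x => encList ((List.finRange x.1.toSTCut.m).map fun i =>
        .pair (.nat (x.1.tag (x.1.idx i))) (.nat (if i ∈ x.2 then 1 else 0)))) := by
    refine PolyTime.zip (polyTime_tags.lift Sigma.fst) ?_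
    simp only [← encSet_eq]
    exact (PolyTime.refl _).snd
  have hmult : PolyTime (fun x : (I : SSVE) × Finset (Fin I.toSTCut.m) =>
      .pair x.1.enc (encSet x.2)) (fun x => .nat x.1.mult) :=
    (PolyTime.nat_of_unary polyTime_mult).lift Sigma.fst
  have h := PolyTime.sum (l := fun p : (x : (I : SSVE) × Finset (Fin I.toSTCut.m)) × Fin x.1.nV =>
      List.finRange p.1.1.toSTCut.m)
    (w := fun p i => (if i ∈ p.1.2 then 1 else 0) *
      (if p.1.1.tag (p.1.1.idx i) = 0 then p.1.1.mult + 1 else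
        if p.1.1.tag (p.1.1.idx i) = p.2 + 1 then 1 else 0))
    (PolyTime.map (hz.lift Sigma.fst (c := fun p => .nat p.2.1)) ?_)
  · refine h.congr_out fun p => ?_
    simp only [load, ← weight_eq]
    rw [← Fin.sum_univ_def]
    simp
  · have r := PolyTime.refl (fun p : (p : (x : (I : SSVE) × Finset (Fin I.toSTCut.m)) ×
        Fin x.1.nV) × Fin p.1.1.toSTCut.m =>
      Data.pair (.pair (.pair p.1.1.1.enc (encSet p.1.1.2)) (.nat p.1.2.1))
        (.pair (.nat (p.1.1.1.tag (p.1.1.1.idx p.2))) (.nat (if p.2 ∈ p.1.1.2 then 1 else 0))))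
    refine r.snd.snd.mul (PolyTime.natIte (PolyTime.decide_zero r.snd.fst) ?_
      (PolyTime.decide_eq r.snd.fst (r.fst.snd.add (PolyTime.natConst 1))))
    exact r.fst.fst.comp (hmult.reindex fun p : (p : (x : (I : SSVE) × Finset (Fin I.toSTCut.m)) ×
      Fin x.1.nV) × Fin p.1.1.toSTCut.m => p.1.1) |>.add (PolyTime.natConst 1)

theorem polyTime_fromCut :
    PolyTime (fun x : (I : SSVE) × Finset (Fin I.toSTCut.m) => .pair x.1.enc (encSet x.2))
      (fun x => encSet (x.1.fromCut x.2)) := by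
  have hmult : PolyTime (fun x : (I : SSVE) × Finset (Fin I.toSTCut.m) =>
      .pair x.1.enc (encSet x.2)) (fun x => .nat x.1.mult) :=
    (PolyTime.nat_of_unary polyTime_mult).lift Sigma.fst
  have hnU : PolyTime (fun x : (I : SSVE) × Finset (Fin I.toSTCut.m) =>
      .pair x.1.enc (encSet x.2)) (fun x => .nat x.1.nU) :=
    (PolyTime.nat_of_unary polyTime_nU).lift Sigma.fst
  have hbad : PolyTime (fun x : (I : SSVE) × Finset (Fin I.toSTCut.m) =>
      .pair x.1.enc (encSet x.2)) (fun x => encList ((List.finRange x.1.m).map fun e =>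
        .pair (.nat (x.1.edgeAt e).1)
          (.nat (if x.1.mult < x.1.nU + x.1.load x.2 (x.1.edgeAt e).2 then 0 else 1)))) := by
    refine PolyTime.map (polyTime_edges.lift Sigma.fst) ?_
    have r := PolyTime.refl (fun p : (x : (I : SSVE) × Finset (Fin I.toSTCut.m)) × Fin x.1.m =>
      Data.pair (.pair p.1.1.enc (encSet p.1.2)) (p.1.1.encEdge p.2))
    refine r.snd.fst.pair (PolyTime.natIte (PolyTime.decide_lt (hmult.lift Sigma.fst)
      ((hnU.lift Sigma.fst).add ?_)) (PolyTime.natConst 0) (PolyTime.natConst 1))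
    exact (r.fst.pair r.snd.snd).comp (polyTime_load.reindex
      fun p : (x : (I : SSVE) × Finset (Fin I.toSTCut.m)) × Fin x.1.m =>
        ⟨p.1, (p.1.1.edgeAt p.2).2⟩)
  suffices h : PolyTime (fun x : (I : SSVE) × Finset (Fin I.toSTCut.m) =>
      .pair x.1.enc (encSet x.2)) (fun x => encList ((List.finRange x.1.nU).map fun u =>
        .nat (if u ∈ x.1.fromCut x.2 then 1 else 0))) from h.congr_out fun x => encSet_eq _
  refine PolyTime.map ((PolyTime.finRange polyTime_nU).lift Sigma.fst) ?_
  -- A universal condition as a vanishing sum: count the edges at `u` whose other end has too small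
  -- a load.
  have h := PolyTime.decide_zero (PolyTime.sum
    (l := fun p : (x : (I : SSVE) × Finset (Fin I.toSTCut.m)) × Fin x.1.nU =>
      List.finRange p.1.1.m)
    (w := fun p e => if ((p.1.1.edgeAt e).1 : ℕ) = p.2 then
      (if p.1.1.mult < p.1.1.nU + p.1.1.load p.1.2 (p.1.1.edgeAt e).2 then 0 else 1) else 0)
    (PolyTime.map (hbad.lift Sigma.fst (c := fun p => .nat p.2.1)) ?_))
  · refine h.congr_out fun p => ?_
    congr 2
    rw [← Fin.sum_univ_def, Finset.sum_eq_zero_iff]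
    simp only [fromCut, Finset.mem_filter, Finset.mem_univ, true_and, true_implies, eq_iff_iff]
    refine forall_congr' fun e => ?_
    rw [Fin.ext_iff]
    split_ifs <;> tauto
  · have r := PolyTime.refl (fun p : (p : (x : (I : SSVE) × Finset (Fin I.toSTCut.m)) ×
        Fin x.1.nU) × Fin p.1.1.m =>
      Data.pair (.pair (.pair p.1.1.1.enc (encSet p.1.1.2)) (.nat p.1.2.1))
        (.pair (.nat (p.1.1.1.edgeAt p.2).1) (.nat (if p.1.1.1.mult <
          p.1.1.1.nU + p.1.1.1.load p.1.1.2 (p.1.1.1.edgeAt p.2).2 then 0 else 1))))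
    exact PolyTime.natIte (PolyTime.decide_eq r.snd.fst r.fst.snd) r.snd.snd (PolyTime.natConst 0)

end SSVE

namespace SSVE

variable (I : SSVE)

/-! ### Size and quality of the reduction -/

variable {I} in
theorem one_le_n (h : 1 ≤ I.m) : 1 ≤ I.n := by
  have := (I.edgeAt ⟨0, h⟩).1.2
  simp only [n]
  omega

theorem n_toSTCut_le (h : 1 ≤ I.n) : I.toSTCut.n ≤ 3 * I.n ^ 3 := by
  have h₁ : I.n ≤ I.n ^ 3 := Nat.le_self_pow (by norm_num) _
  change I.n + 2 ≤ _
  omega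

theorem m_toSTCut_le : I.toSTCut.m ≤ 3 * (I.m * I.n ^ 2 + I.n ^ 5) := by
  have hm : I.toSTCut.m = I.nV * I.mult + (I.nU + (I.m + (I.m + I.m))) := by
    rw [m_toSTCut]
    simp [gadgets, List.length_flatMap]
  rcases Nat.eq_zero_or_pos I.n with h | h
  · have h₁ : I.m = 0 := by
      by_contra h'
      have := one_le_n (I := I) (by omega)
      omega
    have h₂ : I.nU + I.nV = 0 := h
    have h₃ : I.nV = 0 := by omega
    rw [hm, h₁, h₃]
    omega
  · have hU : I.nU ≤ I.n := by simp [n]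
    have hV : I.nV ≤ I.n := by simp [n]
    have h₁ : I.m ≤ I.m * I.n ^ 2 := Nat.le_mul_of_pos_right _ (by positivity)
    have h₂ : I.n ≤ I.n ^ 5 := Nat.le_self_pow (by norm_num) _
    have h₃ : I.n ^ 4 ≤ I.n ^ 5 := Nat.pow_le_pow_right h (by norm_num)
    have h₄ : I.nV * I.mult ≤ I.n ^ 4 + I.n := by
      calc I.nV * I.mult ≤ I.n * I.mult := by gcongr
        _ = _ := by rw [mult]; ring
    omega

theorem k_toSTCut_le (h : 1 ≤ I.m) : I.toSTCut.k ≤ 3 * (I.m * I.n ^ 2) := by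
  have hn := one_le_n h
  have hU : I.nU ≤ I.n := by simp [n]
  have h₁ : I.m ≤ I.m * I.n ^ 2 := Nat.le_mul_of_pos_right _ (by positivity)
  have h₂ : I.n ≤ I.m * I.n ^ 2 := by
    calc I.n ≤ I.n ^ 2 := Nat.le_self_pow (by norm_num) _
      _ ≤ _ := Nat.le_mul_of_pos_left _ h
  change I.m + (I.nU - I.minCard) + 1 ≤ _
  omega

theorem nU_mul_nV_lt : I.nU * I.nV < I.mult := by
  have hU : I.nU ≤ I.n := by simp [n]
  have hV : I.nV ≤ I.n := by simp [n]
  have h₁ : I.nU * I.nV ≤ I.n ^ 2 := by rw [pow_two]; gcongr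
  have h₂ : I.n ^ 2 ≤ I.n ^ 3 := by
    rcases Nat.eq_zero_or_pos I.n with h | h
    · simp [h]
    · exact Nat.pow_le_pow_right h (by norm_num)
  rw [mult]
  omega

variable {I} in
theorem value_fromCut_le_nat {F : Finset (Fin I.toSTCut.m)} {C : ℕ}
    (hC : I.toSTCut.cost F ≤ (C : ℚ≥0) * (I.mult : ℚ≥0)) : I.value (I.fromCut F) ≤ C := by
  have h₁ := (I.value_fromCut_le F).trans (add_le_add_left hC _)
  have h₂ : I.value (I.fromCut F) * I.mult ≤ C * I.mult + I.nU * I.nV := by exact_mod_cast h₁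
  have h₃ := I.nU_mul_nV_lt
  have h₄ : I.value (I.fromCut F) * I.mult < (C + 1) * I.mult := by
    rw [add_mul]; omega
  exact Nat.lt_succ_iff.1 (Nat.lt_of_mul_lt_mul_right h₄)

theorem value_fromCut_le_real (F : Finset (Fin I.toSTCut.m)) :
    (I.value (I.fromCut F) : ℝ) ≤ (I.toSTCut.cost F : ℝ) / (I.mult : ℝ) + 1 / (I.n : ℝ) := by
  have hpos : (0 : ℝ) < I.mult := by simp only [mult]; positivity
  have h₁ : (I.value (I.fromCut F) : ℝ) * I.mult ≤ I.toSTCut.cost F + I.nU * I.nV := by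
    exact_mod_cast I.value_fromCut_le F
  have h₂ : (I.nU : ℝ) * I.nV ≤ 1 / (I.n : ℝ) * I.mult := by
    rcases Nat.eq_zero_or_pos I.n with h | h
    · have h₂ : I.nU + I.nV = 0 := h
      have h₃ : I.nV = 0 := by omega
      simp [h, h₃]
    · have hn : (0 : ℝ) < I.n := by exact_mod_cast h
      rw [div_mul_eq_mul_div, one_mul, le_div_iff₀ hn]
      have hU : I.nU ≤ I.n := by simp [n]
      have hV : I.nV ≤ I.n := by simp [n]
      have : I.nU * I.nV * I.n ≤ I.mult := by
        calc I.nU * I.nV * I.n ≤ I.n * I.n * I.n := by gcongr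
          _ ≤ I.mult := by rw [mult]; ring_nf; omega
      exact_mod_cast this
  rw [← mul_le_mul_iff_left₀ hpos, add_mul, div_mul_cancel₀ _ hpos.ne']
  exact h₁.trans (by gcongr)

variable {I} in
theorem value_eq_zero (h : I.m = 0) (S : Finset (Fin I.nU)) : I.value S = 0 := by
  rw [value, Finset.card_eq_zero, Finset.eq_empty_iff_forall_notMem]
  intro v hv
  obtain ⟨e, -⟩ := I.mem_nbrs.1 hv
  have := e.2
  omega

/-- The approximation algorithm for small-set vertex expansion obtained from one for
`k`-route cut. -/
theorem exists_algorithm {ρ : ℕ → ℕ → ℕ → ℝ} (hρ : STCut.HasApprox ρ) :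
    ∃ A : (I : SSVE) → Finset (Fin I.nU), PolyTime enc (fun I => encSet (A I)) ∧
      ∀ I : SSVE, I.Feasible (A I) ∧ ∀ r : ℝ, 1 ≤ I.m → BoundsRatio ρ 3 I.m I.n r →
        (∀ S, I.Feasible S → ∀ C : ℕ, r * I.value S ≤ C → I.value (A I) ≤ C) ∧
        (∀ S, I.Feasible S → (I.value (A I) : ℝ) ≤ r * I.value S + 1 / I.n) ∧
        ((∀ S, I.Feasible S → 1 ≤ I.value S) → 1 ≤ r) := by
  obtain ⟨A, hA, hA'⟩ := hρ
  refine ⟨fun I => I.fromCut (A I.toSTCut), ?_, fun I => ⟨I.feasible_fromCut (hA' _).1, ?_⟩⟩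
  · exact ((PolyTime.refl enc).pair (polyTime_toSTCut.comp (hA.reindex toSTCut))).comp
      (polyTime_fromCut.reindex fun I => ⟨I, A I.toSTCut⟩)
  intro r hm hr
  have hpos : (0 : ℝ) < I.mult := by simp only [mult]; positivity
  have hρr := hr _ _ _ (I.k_toSTCut_le hm) I.m_toSTCut_le (I.n_toSTCut_le (one_le_n hm))
  have hcost : ∀ F, I.toSTCut.Feasible F →
      (I.toSTCut.cost (A I.toSTCut) : ℝ) ≤ r * I.toSTCut.cost F := fun F hF =>
    ((hA' _).2 F hF).trans (by gcongr)
  have hS : ∀ S, I.Feasible S →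
      (I.toSTCut.cost (A I.toSTCut) : ℝ) ≤ r * I.value S * I.mult := by
    intro S hS
    have := hcost _ (I.feasible_toCut hS)
    rw [cost_toCut] at this
    push_cast at this
    linarith
  refine ⟨fun S hf C hC => ?_, fun S hf => ?_, fun h => ?_⟩
  · refine value_fromCut_le_nat ?_
    have : (I.toSTCut.cost (A I.toSTCut) : ℝ) ≤ C * I.mult :=
      (hS S hf).trans (by gcongr)
    exact_mod_cast this
  · refine (I.value_fromCut_le_real _).trans ?_
    gcongr
    rw [div_le_iff₀ hpos]
    exact hS S hf
  -- Compare with a cheapest feasible cut. Its cost is positive, since cost 0 would yield a feasible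
  -- set of value 0; the algorithm pays at least this cost and at most `r` times it.
  · classical
    obtain ⟨F, hF, hmin⟩ := Finset.exists_min_image
      (Finset.univ.filter fun F => I.toSTCut.Feasible F) I.toSTCut.cost
      ⟨A I.toSTCut, by simpa using (hA' I.toSTCut).1⟩
    have hF' : I.toSTCut.Feasible F := by simpa using hF
    have h₁ := hmin (A I.toSTCut) (by simpa using (hA' I.toSTCut).1)
    have h₂ : (I.toSTCut.cost F : ℝ) ≤ I.toSTCut.cost (A I.toSTCut) := by exact_mod_cast h₁
    have h₃ : I.toSTCut.cost F ≠ 0 := by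
      intro h₀
      have h₄ := h _ (I.feasible_fromCut hF')
      have h₅ := value_fromCut_le_nat (F := F) (C := 0) (by rw [h₀]; simp)
      omega
    have h₄ : (0 : ℝ) < I.toSTCut.cost F := by exact_mod_cast pos_iff_ne_zero.2 h₃
    have h₅ := h₂.trans (hcost F hF')
    by_contra hr1
    push Not at hr1
    nlinarith

/-! ### Transfer of the approximation ratio to small-set vertex expansion -/

theorem hasApprox_nat {ρ : ℕ → ℕ → ℕ → ℝ} (hρ : STCut.HasApprox ρ) {σ : ℕ → ℕ → ℕ}
    (hσ : ∀ m n, BoundsRatio ρ 3 m n (σ m n : ℝ)) : HasApprox (fun m n => (σ m n : ℝ)) := by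
  obtain ⟨A, hA, hA'⟩ := exists_algorithm hρ
  refine ⟨A, hA, fun I => ⟨(hA' I).1, fun S hS => ?_⟩⟩
  rcases Nat.eq_zero_or_pos I.m with h | h
  · simp [value_eq_zero h]
  · have := ((hA' I).2 _ h (hσ _ _)).1 S hS (σ I.m I.n * I.value S) (by push_cast; rfl)
    change (I.value (A I) : ℝ) ≤ (σ I.m I.n : ℝ) * (I.value S : ℝ)
    exact_mod_cast this

theorem hasApprox_real {ρ : ℕ → ℕ → ℕ → ℝ} (hρ : STCut.HasApprox ρ) {σ : ℕ → ℕ → ℝ}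
    (hσ : ∀ m n, BoundsRatio ρ 3 m n (σ m n)) :
    HasApprox (fun m n => σ m n + 1 / (n : ℝ)) := by
  obtain ⟨A, hA, hA'⟩ := exists_algorithm hρ
  refine ⟨A, hA, fun I => ⟨(hA' I).1, fun S hS => ?_⟩⟩
  rcases Nat.eq_zero_or_pos I.m with h | h
  · simp [value_eq_zero h]
  obtain ⟨h₁, h₂, -⟩ := (hA' I).2 _ h (hσ _ _)
  -- The additive error `1 / n` fits into the ratio only when the comparison value is at least 1.
  -- For value 0, the rounded bound with `C = 0` gives an exact solution.
  rcases Nat.eq_zero_or_pos (I.value S) with h₀ | h₀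
  · have := h₁ S hS 0 (by simp [h₀])
    rw [Nat.le_zero.1 this, h₀]
    simp
  · refine (h₂ S hS).trans ?_
    rw [add_mul]
    gcongr
    have : (1 : ℝ) ≤ I.value S := by exact_mod_cast h₀
    exact le_mul_of_one_le_right (by positivity) this

end SSVE

theorem encRat_div_of_coprime {a b : ℕ} (hb : 0 < b) (h : Nat.Coprime a b) :
    encRat ((a : ℚ≥0) / (b : ℚ≥0)) = .pair (.nat a) (.nat b) := by
  have hb' : (0 : ℤ) < b := by exact_mod_cast hb
  have h₁ := Rat.num_div_eq_of_coprime (a := a) (b := b) hb' (by simpa using h)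
  have h₂ := Rat.den_div_eq_of_coprime (a := a) (b := b) hb' (by simpa using h)
  have e : (((a : ℚ≥0) / (b : ℚ≥0) : ℚ≥0) : ℚ) = ((a : ℤ) : ℚ) / ((b : ℤ) : ℚ) := by
    push_cast; rfl
  rw [encRat, NNRat.num, NNRat.den, e, h₁]
  congr 2
  exact_mod_cast h₂

/-! ### Sets given by characteristic vectors -/

namespace PolyTime

variable {ι : Type*} {inp : ι → Data} {n : ι → ℕ}

theorem of_bits {S : ∀ i, Finset (Fin (n i))}
    (h : PolyTime inp (fun i => encList ((List.finRange (n i)).map fun v =>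
      .nat (if v ∈ S i then 1 else 0)))) : PolyTime inp (fun i => encSet (S i)) :=
  h.congr_out fun _ => encSet_eq _

theorem bits {S : ∀ i, Finset (Fin (n i))} (h : PolyTime inp (fun i => encSet (S i))) :
    PolyTime inp (fun i => encList ((List.finRange (n i)).map fun v =>
      .nat (if v ∈ S i then 1 else 0))) :=
  h.congr_out fun _ => (encSet_eq _).symm

theorem indexed_bits {S : ∀ i, Finset (Fin (n i))} (hn : PolyTime inp (fun i => encUnary (n i)))
    (h : PolyTime inp (fun i => encSet (S i))) :
    PolyTime inp (fun i => encList ((List.finRange (n i)).map fun v =>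
      .pair (.nat v.1) (.nat (if v ∈ S i then 1 else 0)))) :=
  zip (finRange hn) (bits h)

theorem decide_mem {S : ∀ i, Finset (Fin (n i))} {v : ∀ i, Fin (n i)}
    (hn : PolyTime inp (fun i => encUnary (n i))) (h : PolyTime inp (fun i => encSet (S i)))
    (hv : PolyTime inp (fun i => .nat (v i))) :
    PolyTime inp (fun i => .nat (if v i ∈ S i then 1 else 0)) := by
  have h' := sum (l := fun i => List.finRange (n i)) (inp := inp)
    (w := fun i u => if (u : ℕ) = v i then (if u ∈ S i then 1 else 0) else 0)
    (map (indexed_bits hn h) ?_)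
  · refine h'.congr_out fun i => ?_
    rw [← Fin.sum_univ_def]
    simp only [← Fin.ext_iff]
    simp
  · have r := refl (fun p : (i : ι) × Fin (n i) =>
      Data.pair (inp p.1) (.pair (.nat p.2.1) (.nat (if p.2 ∈ S p.1 then 1 else 0))))
    exact natIte (decide_eq r.snd.fst (r.fst.comp (hv.reindex Sigma.fst))) r.snd.snd (natConst 0)

theorem card {S : ∀ i, Finset (Fin (n i))} (h : PolyTime inp (fun i => encSet (S i))) :
    PolyTime inp (fun i => .nat (S i).card) := by
  refine (sum (bits h)).congr_out fun i => ?_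
  rw [← Fin.sum_univ_def]
  simp

theorem decide_subset {S T : ∀ i, Finset (Fin (n i))} (hS : PolyTime inp (fun i => encSet (S i)))
    (hT : PolyTime inp (fun i => encSet (T i))) :
    PolyTime inp (fun i => .nat (if S i ⊆ T i then 1 else 0)) := by
  have h := decide_zero (sum (l := fun i => List.finRange (n i)) (inp := inp)
    (w := fun i v => (if v ∈ S i then 1 else 0) - (if v ∈ T i then 1 else 0))
    (map (zip (bits hS) (bits hT)) ((refl _).snd.fst.sub (refl _).snd.snd)))
  refine h.congr_out fun i => ?_
  congr 2
  rw [← Fin.sum_univ_def, Finset.sum_eq_zero_iff]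
  simp only [Finset.mem_univ, true_implies, eq_iff_iff, Finset.subset_iff]
  refine forall_congr' fun v => ?_
  split_ifs <;> simp_all

end PolyTime

namespace SSVE

theorem mem_nbrs_iff (I : SSVE) {S : Finset (Fin I.nU)} {v : Fin I.nV} :
    v ∈ I.nbrs S ↔ ∃ u ∈ S, (u, v) ∈ I.edges := by
  simp [nbrs]

theorem polyTime_nbrs : PolyTime (fun x : (I : SSVE) × Finset (Fin I.nU) =>
    .pair x.1.enc (encSet x.2)) (fun x => encSet (x.1.nbrs x.2)) := by
  refine PolyTime.of_bits (PolyTime.map ((PolyTime.finRange polyTime_nV).lift Sigma.fst) ?_)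
  have hmem : PolyTime (fun x : (I : SSVE) × Finset (Fin I.nU) => .pair x.1.enc (encSet x.2))
      (fun x => encList ((List.finRange x.1.m).map fun e =>
        .pair (.nat (x.1.edgeAt e).2) (.nat (if (x.1.edgeAt e).1 ∈ x.2 then 1 else 0)))) := by
    refine PolyTime.map (polyTime_edges.lift Sigma.fst) ?_
    have r := PolyTime.refl (fun p : (x : (I : SSVE) × Finset (Fin I.nU)) × Fin x.1.m =>
      Data.pair (.pair p.1.1.enc (encSet p.1.2)) (p.1.1.encEdge p.2))
    exact r.snd.snd.pair (PolyTime.decide_mem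
      (n := fun p : (x : (I : SSVE) × Finset (Fin I.nU)) × Fin x.1.m => p.1.1.nU)
      (r.fst.fst.comp (polyTime_nU.reindex
        fun p : (x : (I : SSVE) × Finset (Fin I.nU)) × Fin x.1.m => p.1.1)) r.fst.snd r.snd.fst)
  have h := PolyTime.decide_lt (PolyTime.natConst 0) (PolyTime.sum
    (l := fun p : (x : (I : SSVE) × Finset (Fin I.nU)) × Fin x.1.nV => List.finRange p.1.1.m)
    (w := fun p e => if ((p.1.1.edgeAt e).2 : ℕ) = p.2 then
      (if (p.1.1.edgeAt e).1 ∈ p.1.2 then 1 else 0) else 0)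
    (PolyTime.map (hmem.lift Sigma.fst (c := fun p => .nat p.2.1)) ?_))
  · refine h.congr_out fun p => ?_
    congr 2
    rw [← Fin.sum_univ_def, Finset.sum_pos_iff]
    simp only [mem_nbrs, Finset.mem_univ, true_and, eq_iff_iff]
    refine exists_congr fun e => ?_
    rw [Fin.ext_iff]
    split_ifs <;> simp_all
  · have r := PolyTime.refl (fun p : (p : (x : (I : SSVE) × Finset (Fin I.nU)) ×
        Fin x.1.nV) × Fin p.1.1.m =>
      Data.pair (.pair (.pair p.1.1.1.enc (encSet p.1.1.2)) (.nat p.1.2.1))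
        (.pair (.nat (p.1.1.1.edgeAt p.2).2)
          (.nat (if (p.1.1.1.edgeAt p.2).1 ∈ p.1.1.2 then 1 else 0))))
    exact PolyTime.natIte (PolyTime.decide_eq r.snd.fst r.fst.snd) r.snd.snd (PolyTime.natConst 0)

end SSVE

namespace DkS

variable {l : ℕ} (I : DkS l)

/-! ### From hypergraphs to bipartite graphs -/

def hAt (u : Fin I.m) : Finset (Fin I.n) := I.hyperedges.get u

theorem hAt_card (u : Fin I.m) : (I.hAt u).card = l := I.uniform _ (List.get_mem _ _)

def incidences : List (Fin I.m × Fin I.n) :=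
  (List.finRange I.m).flatMap fun u =>
    ((List.finRange I.n).filter fun v => v ∈ I.hAt u).map fun v => (u, v)

theorem mem_incidences {u : Fin I.m} {v : Fin I.n} : (u, v) ∈ I.incidences ↔ v ∈ I.hAt u := by
  simp [incidences]

theorem incidences_nodup : I.incidences.Nodup := by
  rw [incidences, List.nodup_flatMap]
  refine ⟨fun u _ => ((List.nodup_finRange _).filter _).map fun _ _ h => by simpa using h, ?_⟩
  refine (List.nodup_finRange I.m).imp ?_
  intro a b hab
  simp only [Function.onFun, List.disjoint_left]
  rintro x hx hx'
  obtain ⟨w, -, rfl⟩ := List.mem_map.1 hx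
  obtain ⟨w', -, h⟩ := List.mem_map.1 hx'
  exact hab (congrArg Prod.fst h).symm

theorem incidences_length : I.incidences.length = l * I.m := by
  have h : ∀ u, (((List.finRange I.n).filter fun v => v ∈ I.hAt u).map
      fun v => (u, v)).length = l := by
    intro u
    rw [List.length_map, ← List.toFinset_card_of_nodup ((List.nodup_finRange _).filter _)]
    refine Eq.trans (congrArg Finset.card ?_) (I.hAt_card u)
    ext v
    simp
  simp only [incidences, List.length_flatMap, h]
  simp [mul_comm]

/-- The numerator of a number whose product with `m` lies just below `j + 1`. -/
def alphaNum (j : Fin I.m) : ℕ := 2 * (j + 1) * I.m - 1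

def alphaDen : ℕ := 2 * I.m ^ 2

theorem alphaNum_add_one (j : Fin I.m) : I.alphaNum j + 1 = 2 * (j + 1) * I.m := by
  have : 0 < 2 * (j.1 + 1) * I.m := by have := j.pos; positivity
  rw [alphaNum]
  omega

theorem alphaDen_pos (j : Fin I.m) : 0 < I.alphaDen := by
  have := j.pos
  rw [alphaDen]
  positivity

/-- The numerator is one less than a multiple of both 2 and `m`. Hence the fraction is already
reduced and its encoding needs only arithmetic, whereas `(j + 1) / m` would require computing a
greatest common divisor. -/
theorem alpha_coprime (j : Fin I.m) : Nat.Coprime (I.alphaNum j) I.alphaDen := by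
  have h : Nat.Coprime (I.alphaNum j) (2 * (j + 1) * I.m) := by
    rw [← alphaNum_add_one]; simp
  have h₂ : Nat.Coprime (I.alphaNum j) 2 := h.coprime_dvd_right ⟨(j + 1) * I.m, by ring⟩
  have hm : Nat.Coprime (I.alphaNum j) I.m := h.coprime_dvd_right ⟨2 * (j + 1), by ring⟩
  exact Nat.Coprime.mul_right h₂ (hm.pow_right 2)

/-- The bipartite graph of hyperedges and nodes, where `j + 1` hyperedges are to be chosen. -/
def toSSVE (j : Fin I.m) : SSVE where
  nU := I.m
  nV := I.n
  edges := I.incidences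
  nodup := I.incidences_nodup
  α := (I.alphaNum j : ℚ≥0) / (I.alphaDen : ℚ≥0)
  α_pos := by
    have h₁ := I.alphaNum_add_one j
    have h₂ := I.alphaDen_pos j
    have h₃ : 2 ≤ 2 * (j.1 + 1) * I.m := by
      rw [mul_assoc]
      exact Nat.le_mul_of_pos_right _ (Nat.mul_pos (by omega) j.pos)
    have h₄ : 0 < I.alphaNum j := by omega
    positivity
  α_le_one := by
    have h₂ := I.alphaDen_pos j
    rw [div_le_one (by exact_mod_cast h₂)]
    have h₁ := I.alphaNum_add_one j
    have h₃ : 2 * (j.1 + 1) * I.m ≤ I.alphaDen := by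
      have := j.2
      rw [alphaDen, pow_two, ← mul_assoc]
      gcongr
      omega
    exact_mod_cast (by omega : I.alphaNum j ≤ I.alphaDen)

theorem m_toSSVE (j : Fin I.m) : (I.toSSVE j).m = l * I.m := I.incidences_length

theorem n_toSSVE (j : Fin I.m) : (I.toSSVE j).n = I.m + I.n := rfl

/-- The threshold `α * m` equals `j + 1 - 1 / (2 * m)`, which for integers is the same as `j + 1`.
-/
theorem feasible_toSSVE (j : Fin I.m) (S : Finset (Fin I.m)) :
    (I.toSSVE j).Feasible S ↔ j.1 + 1 ≤ S.card := by
  have h₁ := I.alphaNum_add_one j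
  have h₂ := I.alphaDen_pos j
  have hm := j.pos
  change (I.alphaNum j : ℚ≥0) / (I.alphaDen : ℚ≥0) * (I.m : ℚ≥0) ≤ (S.card : ℚ≥0) ↔ _
  rw [div_mul_eq_mul_div, div_le_iff₀ (by exact_mod_cast h₂)]
  norm_cast
  have e : S.card * I.alphaDen = (2 * S.card * I.m) * I.m := by rw [alphaDen]; ring
  rw [e, Nat.mul_le_mul_right_iff hm]
  constructor
  · intro h
    by_contra hlt
    have h₃ : 2 * S.card * I.m ≤ 2 * j * I.m := by gcongr; omega
    have h₄ : 2 * (j.1 + 1) * I.m = 2 * j * I.m + 2 * I.m := by ring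
    omega
  · intro h
    have h₃ : 2 * (j.1 + 1) * I.m ≤ 2 * S.card * I.m := by gcongr
    omega

theorem mem_nbrs_toSSVE {j : Fin I.m} {S : Finset (Fin I.m)} {v : Fin I.n} :
    v ∈ (I.toSSVE j).nbrs S ↔ ∃ u ∈ S, v ∈ I.hAt u := by
  exact (SSVE.mem_nbrs_iff (I.toSSVE j)).trans
    (exists_congr fun u => and_congr_right fun _ => I.mem_incidences)

/-! ### The algorithm -/

/-- Adds or removes a node. -/
def toggle (Q : Finset (Fin I.n)) (v : Fin I.n) : Finset (Fin I.n) := symmDiff Q {v}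

/-- Orders sets by the distance of their size to `k`, then by the number of hyperedges. -/
def score (T : Finset (Fin I.n)) : ℕ :=
  I.value T + (I.m + 1) * (I.n - ((T.card - I.k) + (I.k - T.card)))

def best (b : Finset (Fin I.n)) (L : List (Finset (Fin I.n))) : Finset (Fin I.n) :=
  L.foldl (fun b x => if I.score b < I.score x then x else b) b

def moves (Q : Finset (Fin I.n)) : List (Finset (Fin I.n)) := (List.finRange I.n).map (I.toggle Q)

/-- The best set that differs from `Q` in at most one node. -/
def improve (Q : Finset (Fin I.n)) : Finset (Fin I.n) := I.best Q (I.moves Q)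

/-- A set of `k` nodes obtained greedily from `Q`. -/
def normalize (Q : Finset (Fin I.n)) : Finset (Fin I.n) := I.improve^[I.n] Q

/-- All sets of at most `K` nodes. -/
def smallSets : ℕ → List (Finset (Fin I.n))
  | 0 => [∅]
  | K + 1 => (smallSets K).flatMap fun Q => Q :: I.moves Q

/-- The nodes of the hyperedges chosen by `A` when asked for `j + 1` hyperedges. -/
def covered (A : (I : SSVE) → Finset (Fin I.nU)) (j : Fin I.m) : Finset (Fin I.n) :=
  (I.toSSVE j).nbrs (A (I.toSSVE j))

def candidates (A : (I : SSVE) → Finset (Fin I.nU)) (K : ℕ) : List (Finset (Fin I.n)) :=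
  (List.finRange I.m).map (I.covered A) ++ I.smallSets K

/-- Every set compared here is normalized, hence has exactly `k` nodes, so the score ranks by value
alone. All `j` are tried because the optimum is unknown. -/
def solve (A : (I : SSVE) → Finset (Fin I.nU)) (K : ℕ) : Finset (Fin I.n) :=
  I.best (I.normalize ∅) ((I.candidates A K).map I.normalize)

theorem value_eq_sum (T : Finset (Fin I.n)) :
    I.value T = ∑ u : Fin I.m, if I.hAt u ⊆ T then 1 else 0 := by
  have h : ∀ L : List (Finset (Fin I.n)), (L.filter fun e => e ⊆ T).length =
      (L.map fun e => if e ⊆ T then 1 else 0).sum := by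
    intro L
    induction L with
    | nil => simp
    | cons e L ih =>
      rw [List.map_cons, List.sum_cons, ← ih, List.filter_cons]
      by_cases he : e ⊆ T <;> simp [he, add_comm]
  rw [value, h, Fin.sum_univ_def]
  congr 1
  refine List.ext_getElem (by simp [m]) fun j _ _ => ?_
  simp only [List.getElem_map, List.getElem_finRange]
  rfl

/-! ### The algorithm runs in polynomial time -/

section

variable {ι : Type*} {inp : ι → Data} {J : ι → DkS l}

theorem polyTime_n (hJ : PolyTime inp (fun i => (J i).enc)) :
    PolyTime inp (fun i => encUnary (J i).n) := hJ.fst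

theorem polyTime_hyperedges (hJ : PolyTime inp (fun i => (J i).enc)) :
    PolyTime inp (fun i => encList ((List.finRange (J i).m).map fun u => encSet ((J i).hAt u))) := by
  refine PolyTime.congr_out hJ.snd.fst fun i => ?_
  congr 1
  refine List.ext_getElem (by simp [m]) fun j _ _ => ?_
  simp only [List.getElem_map, List.getElem_finRange]
  rfl

theorem polyTime_m (hJ : PolyTime inp (fun i => (J i).enc)) :
    PolyTime inp (fun i => encUnary (J i).m) := by
  simpa using PolyTime.unary_length (polyTime_hyperedges hJ)

variable {T : ∀ i, Finset (Fin (J i).n)}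

theorem polyTime_value (hJ : PolyTime inp (fun i => (J i).enc))
    (hT : PolyTime inp (fun i => encSet (T i))) :
    PolyTime inp (fun i => .nat ((J i).value (T i))) := by
  have h := PolyTime.sum (l := fun i => List.finRange (J i).m) (inp := inp)
    (w := fun i u => if (J i).hAt u ⊆ T i then 1 else 0)
    (PolyTime.map (polyTime_hyperedges hJ) (PolyTime.decide_subset
      (n := fun p : (i : ι) × Fin (J i).m => (J p.1).n)
      (PolyTime.refl _).snd (hT.lift Sigma.fst)))
  refine h.congr_out fun i => ?_
  rw [value_eq_sum, Fin.sum_univ_def]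

theorem polyTime_score (hJ : PolyTime inp (fun i => (J i).enc))
    (hT : PolyTime inp (fun i => encSet (T i))) :
    PolyTime inp (fun i => .nat ((J i).score (T i))) := by
  have hk := hJ.snd.snd
  have hc := PolyTime.card (n := fun i => (J i).n) hT
  exact (polyTime_value hJ hT).add (((PolyTime.nat_of_unary (polyTime_m hJ)).add
    (PolyTime.natConst 1)).mul ((PolyTime.nat_of_unary (polyTime_n hJ)).sub
      ((hc.sub hk).add (hk.sub hc))))

/-- A bound uniform in the set, which serves for every accumulator that is a set of nodes. -/
theorem exists_size_encSet_le (hJ : PolyTime inp (fun i => (J i).enc)) :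
    ∃ Q : Polynomial ℕ, ∀ i (S : Finset (Fin (J i).n)), (encSet S).size ≤ Q.eval (inp i).size := by
  obtain ⟨Q, hQ⟩ := (polyTime_n hJ).size_bound
  refine ⟨1 + Q * 3, fun i S => ?_⟩
  have h₁ := length_le_size (List.replicate (J i).n (Data.nat 0))
  have h₂ := hQ i
  have h₃ := size_encList_le ((List.finRange (J i).n).map fun v =>
    Data.nat (if v ∈ S then 1 else 0)) 2 (by
      intro d hd
      obtain ⟨v, -, rfl⟩ := List.mem_map.1 hd
      by_cases hv : v ∈ S <;> simp [hv, Data.size])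
  rw [← encSet_eq, List.length_map, List.length_finRange] at h₃
  simp only [Polynomial.eval_add, Polynomial.eval_mul, Polynomial.eval_one,
    Polynomial.eval_ofNat, encUnary, List.length_replicate] at h₁ h₂ ⊢
  omega

theorem polyTime_best {L : ∀ i, List (Finset (Fin (J i).n))}
    (hJ : PolyTime inp (fun i => (J i).enc)) (hT : PolyTime inp (fun i => encSet (T i)))
    (hL : PolyTime inp (fun i => encList ((L i).map encSet))) :
    PolyTime inp (fun i => encSet ((J i).best (T i) (L i))) := by
  refine PolyTime.foldl (σ := fun i => Finset (Fin (J i).n)) (es := fun _ S => encSet S) hL hT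
    ?_ ?_
  · have r := PolyTime.refl (fun p : (i : ι) × Finset (Fin (J i).n) × Finset (Fin (J i).n) =>
      Data.pair (inp p.1) (.pair (encSet p.2.1) (encSet p.2.2)))
    have hJ' := r.fst.comp (hJ.reindex
      fun p : (i : ι) × Finset (Fin (J i).n) × Finset (Fin (J i).n) => p.1)
    refine (PolyTime.ite (PolyTime.decide_lt (polyTime_score hJ' r.snd.snd)
      (polyTime_score hJ' r.snd.fst)) r.snd.fst r.snd.snd).congr_out fun p => ?_
    split_ifs <;> rfl
  · obtain ⟨Q, hQ⟩ := exists_size_encSet_le hJ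
    exact ⟨Q, fun i j => hQ i _⟩

theorem polyTime_moves (hJ : PolyTime inp (fun i => (J i).enc))
    (hT : PolyTime inp (fun i => encSet (T i))) :
    PolyTime inp (fun i => encList (((J i).moves (T i)).map encSet)) := by
  simp only [moves, List.map_map, Function.comp_def]
  refine PolyTime.map (PolyTime.finRange (polyTime_n hJ)) ?_
  refine PolyTime.of_bits (n := fun p : (i : ι) × Fin (J i).n => (J p.1).n) ?_
  have h := PolyTime.map (inp := fun p : (i : ι) × Fin (J i).n => .pair (inp p.1) (.nat p.2.1))
    (g := fun p (v : Fin (J p.1).n) => .nat (if (v : ℕ) = p.2 then 1 - (if v ∈ T p.1 then 1 else 0) else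
      (if v ∈ T p.1 then 1 else 0)))
    ((PolyTime.indexed_bits (n := fun i => (J i).n) (polyTime_n hJ) hT).lift Sigma.fst) ?_
  · refine h.congr_out fun p => ?_
    congr 2
    funext v
    simp only [toggle, Finset.mem_symmDiff, Finset.mem_singleton, ← Fin.ext_iff]
    congr 1
    split_ifs <;> simp_all
  · have r := PolyTime.refl (fun p : (p : (i : ι) × Fin (J i).n) × Fin (J p.1).n =>
      Data.pair (.pair (inp p.1.1) (.nat p.1.2.1))
        (.pair (.nat p.2.1) (.nat (if p.2 ∈ T p.1.1 then 1 else 0))))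
    exact PolyTime.natIte (PolyTime.decide_eq r.snd.fst r.fst.snd)
      ((PolyTime.natConst 1).sub r.snd.snd) r.snd.snd

theorem polyTime_improve (hJ : PolyTime inp (fun i => (J i).enc))
    (hT : PolyTime inp (fun i => encSet (T i))) :
    PolyTime inp (fun i => encSet ((J i).improve (T i))) :=
  polyTime_best hJ hT (polyTime_moves hJ hT)

theorem polyTime_normalize (hJ : PolyTime inp (fun i => (J i).enc))
    (hT : PolyTime inp (fun i => encSet (T i))) :
    PolyTime inp (fun i => encSet ((J i).normalize (T i))) := by
  have h := PolyTime.iterate (inp := inp) (l := fun i => List.replicate (J i).n (.nat 0))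
    (acc := fun i j => encSet ((J i).improve^[j] (T i))) (polyTime_n hJ) hT ?_ ?_
  · exact h.congr_out fun i => by rw [List.length_replicate]; rfl
  · simp only [Function.iterate_succ', Function.comp_def]
    have r := PolyTime.refl
      (fun p : (i : ι) × Fin (List.replicate (J i).n (Data.nat 0)).length =>
        Data.pair (inp p.1) (.pair ((List.replicate (J p.1).n (Data.nat 0)).get p.2)
          (encSet ((J p.1).improve^[p.2] (T p.1)))))
    exact polyTime_improve (r.fst.comp (hJ.reindex Sigma.fst)) r.snd.snd
  · obtain ⟨Q, hQ⟩ := exists_size_encSet_le hJ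
    exact ⟨Q, fun i j _ => hQ i _⟩

theorem polyTime_empty (hJ : PolyTime inp (fun i => (J i).enc)) :
    PolyTime inp (fun i => encSet (∅ : Finset (Fin (J i).n))) := by
  refine (polyTime_n hJ).congr_out fun i => ?_
  rw [encSet_eq]
  simp [encUnary]

/-- `K` is a constant: the program and its polynomial bound are built by recursion on it. -/
theorem polyTime_smallSets (K : ℕ) (hJ : PolyTime inp (fun i => (J i).enc)) :
    PolyTime inp (fun i => encList (((J i).smallSets K).map encSet)) := by
  induction K with
  | zero => exact PolyTime.cons (polyTime_empty hJ) PolyTime.nil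
  | succ K ih =>
    simp only [smallSets, List.map_flatMap]
    refine PolyTime.flatMap ih ?_
    simp only [List.map_cons]
    exact PolyTime.cons (PolyTime.refl _).snd
      (polyTime_moves (J := fun p : (i : ι) × Finset (Fin (J i).n) => J p.1) (hJ.lift Sigma.fst)
        (PolyTime.refl _).snd)

end

theorem polyTime_toSSVE : PolyTime (fun p : (I : DkS l) × Fin I.m => .pair p.1.enc (.nat p.2.1))
    (fun p => (p.1.toSSVE p.2).enc) := by
  have hm := polyTime_m (PolyTime.refl (enc (l := l)))
  have hn := polyTime_n (PolyTime.refl (enc (l := l)))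
  have hm' := PolyTime.nat_of_unary hm
  have hinc : PolyTime (enc (l := l)) (fun I =>
      encList (I.incidences.map fun e => .pair (.nat e.1) (.nat e.2))) := by
    simp only [incidences, List.map_flatMap, List.map_map, Function.comp_def]
    refine PolyTime.flatMap (PolyTime.zip (PolyTime.finRange hm)
      (polyTime_hyperedges (PolyTime.refl enc))) ?_
    have e : ∀ {α : Type} (L : List α) (p : α → Bool) (g : α → Data),
        (L.filter p).map g = L.flatMap fun a => if p a then [g a] else [] := by
      intro α L p g
      induction L with
      | nil => simp
      | cons a L ih => by_cases h : p a <;> simp [h, ih, List.flatMap_cons]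
    simp only [e]
    have r := PolyTime.refl (fun p : (I : DkS l) × Fin I.m =>
      Data.pair p.1.enc (.pair (.nat p.2.1) (encSet (p.1.hAt p.2))))
    refine PolyTime.flatMap (PolyTime.indexed_bits (n := fun p : (I : DkS l) × Fin I.m => p.1.n)
      (hn.lift Sigma.fst) r.snd.snd) ?_
    have r' := PolyTime.refl (fun p : (p : (I : DkS l) × Fin I.m) × Fin p.1.n =>
      Data.pair (.pair p.1.1.enc (.pair (.nat p.1.2.1) (encSet (p.1.1.hAt p.1.2))))
        (.pair (.nat p.2.1) (.nat (if p.2 ∈ p.1.1.hAt p.1.2 then 1 else 0))))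
    refine (PolyTime.ite r'.snd.snd (PolyTime.cons (r'.fst.snd.fst.pair r'.snd.fst)
      PolyTime.nil) PolyTime.nil).congr_out fun p => ?_
    by_cases h : p.2 ∈ p.1.1.hAt p.1.2 <;> simp [h]
  have r := PolyTime.refl (fun p : (I : DkS l) × Fin I.m => Data.pair p.1.enc (.nat p.2.1))
  have hnum := (((PolyTime.natConst 2).mul (r.snd.add (PolyTime.natConst 1))).mul
    (hm'.lift Sigma.fst)).sub (PolyTime.natConst 1)
  have hden := ((PolyTime.natConst 2).mul (hm'.mul hm')).lift
    (Sigma.fst : ((I : DkS l) × Fin I.m) → DkS l) (c := fun p => .nat p.2.1)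
  refine ((hm.lift Sigma.fst).pair ((hn.lift Sigma.fst).pair ((hinc.lift Sigma.fst).pair
    (hnum.pair hden)))).congr_out fun p => ?_
  simp only [SSVE.enc, toSSVE]
  rw [encRat_div_of_coprime (p.1.alphaDen_pos p.2) (p.1.alpha_coprime p.2), alphaDen, pow_two]
  rfl

theorem polyTime_solve {A : (I : SSVE) → Finset (Fin I.nU)}
    (hA : PolyTime SSVE.enc (fun I => encSet (A I))) (K : ℕ) :
    PolyTime (enc (l := l)) (fun I => encSet (I.solve A K)) := by
  have hJ := PolyTime.refl (enc (l := l))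
  refine polyTime_best hJ (polyTime_normalize hJ (polyTime_empty hJ)) ?_
  have hc : PolyTime (enc (l := l)) (fun I => encList ((I.candidates A K).map encSet)) := by
    simp only [candidates, List.map_append, List.map_map, Function.comp_def]
    refine PolyTime.append (PolyTime.map (PolyTime.finRange (polyTime_m hJ)) ?_)
      (polyTime_smallSets K hJ)
    exact (polyTime_toSSVE.pair (polyTime_toSSVE.comp (hA.reindex
      fun p : (I : DkS l) × Fin I.m => p.1.toSSVE p.2))).comp (SSVE.polyTime_nbrs.reindex
        fun p : (I : DkS l) × Fin I.m => ⟨p.1.toSSVE p.2, A (p.1.toSSVE p.2)⟩)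
  simp only [List.map_map, Function.comp_def]
  exact PolyTime.map hc (polyTime_normalize
    (J := fun p : (I : DkS l) × Finset (Fin I.n) => p.1) (hJ.lift Sigma.fst)
    (PolyTime.refl _).snd)

end DkS

/-! ### Falling factorials -/

/-- All factors are at least `k - l`, and by Bernoulli `(1 - l / k) ^ l ≥ 1 - l ^ 2 / k ≥ 1 / 2`. -/
theorem pow_le_two_mul_descFactorial {k l : ℕ} (h : 2 * l * l ≤ k) :
    k ^ l ≤ 2 * k.descFactorial l := by
  rcases Nat.eq_zero_or_pos l with rfl | hl
  · simp
  have hk : 0 < k := lt_of_lt_of_le (by positivity) h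
  have hlk : l ≤ k := le_trans (by nlinarith) h
  have hk' : (0 : ℝ) < k := by exact_mod_cast hk
  have h₁ : ((k - l : ℕ) : ℝ) ^ l ≤ k.descFactorial l := by
    have := Nat.pow_sub_le_descFactorial k l
    have h' : (k - l) ^ l ≤ (k + 1 - l) ^ l := Nat.pow_le_pow_left (by omega) _
    exact_mod_cast h'.trans this
  have h₂ : (1 : ℝ) + l * (-(l / k)) ≤ (1 + -(l / k)) ^ l := by
    refine one_add_mul_le_pow ?_ l
    have : (l : ℝ) / k ≤ 1 := by rw [div_le_one hk']; exact_mod_cast hlk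
    linarith
  have h₃ : (l : ℝ) * (l / k) ≤ 1 / 2 := by
    rw [mul_div_assoc', div_le_iff₀ hk']
    have : (2 * l * l : ℝ) ≤ k := by exact_mod_cast h
    linarith
  have h₄ : ((k - l : ℕ) : ℝ) = k * (1 + -(l / k)) := by
    rw [Nat.cast_sub hlk]
    field_simp
    ring
  rw [h₄, mul_pow] at h₁
  have h₅ : (k : ℝ) ^ l * (1 / 2) ≤ k ^ l * (1 + -(l / k)) ^ l := by
    gcongr
    linarith
  have h₆ : (k : ℝ) ^ l ≤ 2 * k.descFactorial l := by linarith
  exact_mod_cast h₆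

/-- As `l ≥ 2`, the falling factorial contains a factor at most `q - 1`, so it is at most `q ^ l *
(1 - 1 / q)`. By Bernoulli and `l ≤ N` this is at most `(q - 1 / N) ^ l`, which removes the additive
error. -/
theorem descFactorial_le_pow_real {q l N : ℕ} {x : ℝ} (hl : 2 ≤ l) (hN : l ≤ N) (hq : 1 ≤ q)
    (h : (q : ℝ) ≤ x + 1 / N) : (q.descFactorial l : ℝ) ≤ x ^ l := by
  have hq' : (1 : ℝ) ≤ q := by exact_mod_cast hq
  have hN' : (2 : ℝ) ≤ N := by exact_mod_cast hl.trans hN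
  have h₁ : (q : ℝ) * (1 + -(1 / (N * q))) ≤ x := by
    have : (q : ℝ) * (1 + -(1 / (N * q))) = q - 1 / N := by field_simp; ring
    rw [this]
    linarith
  have h₂ : (1 : ℝ) / (N * q) ≤ 1 := by
    rw [div_le_one (by positivity)]
    nlinarith
  have h₃ : (1 : ℝ) + l * (-(1 / (N * q))) ≤ (1 + -(1 / (N * q))) ^ l :=
    one_add_mul_le_pow (by linarith) l
  have h₄ : (l : ℝ) * (1 / (N * q)) ≤ 1 / q := by
    rw [mul_one_div, div_le_div_iff₀ (by positivity) (by positivity)]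
    have : (l : ℝ) ≤ N := by exact_mod_cast hN
    nlinarith
  obtain ⟨l', rfl⟩ : ∃ l', l = l' + 2 := ⟨l - 2, by omega⟩
  have h₅ : q.descFactorial (l' + 2) ≤ q ^ (l' + 1) * (q - 1) := by
    obtain ⟨q', rfl⟩ : ∃ q', q = q' + 1 := ⟨q - 1, by omega⟩
    rw [Nat.succ_descFactorial_succ, pow_succ', mul_assoc]
    gcongr
    calc q'.descFactorial (l' + 1) ≤ q' ^ (l' + 1) := Nat.descFactorial_le_pow _ _
      _ = q' ^ l' * q' := pow_succ _ _
      _ ≤ (q' + 1) ^ l' * (q' + 1 - 1) := by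
        gcongr <;> omega
  have h₆ : ((q.descFactorial (l' + 2) : ℕ) : ℝ) ≤ q ^ (l' + 1) * (q - 1) := by
    have : ((q.descFactorial (l' + 2) : ℕ) : ℝ) ≤ ((q ^ (l' + 1) * (q - 1) : ℕ) : ℝ) := by
      exact_mod_cast h₅
    rwa [Nat.cast_mul, Nat.cast_pow, Nat.cast_sub hq, Nat.cast_one] at this
  calc ((q.descFactorial (l' + 2) : ℕ) : ℝ) ≤ q ^ (l' + 1) * (q - 1) := h₆
    _ = q ^ (l' + 2) * (1 - 1 / q) := by field_simp; ring
    _ ≤ q ^ (l' + 2) * (1 + -(1 / (N * q))) ^ (l' + 2) := by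
      gcongr
      linarith
    _ = (q * (1 + -(1 / (N * q)))) ^ (l' + 2) := (mul_pow _ _ _).symm
    _ ≤ x ^ (l' + 2) := by
      have : (0 : ℝ) ≤ 1 + -(1 / (N * q)) := by linarith
      gcongr

namespace DkS

variable {l : ℕ} (I : DkS l)

/-! ### Correctness of the algorithm -/

theorem value_mono {S T : Finset (Fin I.n)} (h : S ⊆ T) : I.value S ≤ I.value T := by
  rw [value_eq_sum, value_eq_sum]
  refine Finset.sum_le_sum fun u _ => ?_
  by_cases hu : I.hAt u ⊆ S
  · simp [hu, hu.trans h]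
  · simp [hu]

theorem value_le (T : Finset (Fin I.n)) : I.value T ≤ I.m := List.length_filter_le _ _

/-- The distance of the size of a set from `k`. -/
def dist (T : Finset (Fin I.n)) : ℕ := (T.card - I.k) + (I.k - T.card)

theorem dist_le (T : Finset (Fin I.n)) : I.dist T ≤ I.n := by
  have h₁ := Finset.card_le_univ T
  have h₂ := I.k_le
  rw [Fintype.card_fin] at h₁
  rw [dist]
  omega

/-- One unit of distance weighs `m + 1`, more than any difference of values, so the score is
lexicographic. -/
theorem dist_le_of_score_le {S T : Finset (Fin I.n)} (h : I.score S ≤ I.score T) :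
    I.dist T ≤ I.dist S := by
  by_contra hlt
  have h₁ := I.value_le T
  have h₂ := I.dist_le T
  have h₃ : (I.m + 1) * (I.n - I.dist T) + (I.m + 1) ≤ (I.m + 1) * (I.n - I.dist S) := by
    rw [← Nat.mul_succ]
    gcongr
    omega
  change I.value S + (I.m + 1) * (I.n - I.dist S) ≤
    I.value T + (I.m + 1) * (I.n - I.dist T) at h
  omega

theorem value_le_of_score_le {S T : Finset (Fin I.n)} (h : I.score S ≤ I.score T)
    (hd : I.dist S = I.dist T) : I.value S ≤ I.value T := by
  change I.value S + (I.m + 1) * (I.n - I.dist S) ≤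
    I.value T + (I.m + 1) * (I.n - I.dist T) at h
  rw [hd] at h
  omega

theorem best_spec (b : Finset (Fin I.n)) (L : List (Finset (Fin I.n))) :
    I.best b L ∈ b :: L ∧ ∀ x ∈ b :: L, I.score x ≤ I.score (I.best b L) := by
  induction L generalizing b with
  | nil => simp [best]
  | cons y L ih =>
    obtain ⟨h₁, h₂⟩ := ih (if I.score b < I.score y then y else b)
    have e : I.best b (y :: L) = I.best (if I.score b < I.score y then y else b) L := rfl
    rw [e]
    refine ⟨?_, fun x hx => ?_⟩
    · rcases List.mem_cons.1 h₁ with h | h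
      · rw [h]
        split_ifs <;> simp
      · exact List.mem_cons_of_mem _ (List.mem_cons_of_mem _ h)
    · have h₃ := h₂ _ List.mem_cons_self
      rcases List.mem_cons.1 hx with rfl | hx
      · refine le_trans ?_ h₃
        split_ifs with h
        · exact h.le
        · exact le_rfl
      rcases List.mem_cons.1 hx with rfl | hx
      · refine le_trans ?_ h₃
        split_ifs with h
        · exact le_rfl
        · exact not_lt.1 h
      · exact h₂ _ (List.mem_cons_of_mem _ hx)

theorem toggle_of_mem {Q : Finset (Fin I.n)} {v : Fin I.n} (h : v ∈ Q) :
    I.toggle Q v = Q.erase v := by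
  ext x
  simp only [toggle, Finset.mem_symmDiff, Finset.mem_singleton, Finset.mem_erase]
  by_cases hx : x = v
  · subst hx; tauto
  · tauto

theorem toggle_of_notMem {Q : Finset (Fin I.n)} {v : Fin I.n} (h : v ∉ Q) :
    I.toggle Q v = insert v Q := by
  ext x
  simp only [toggle, Finset.mem_symmDiff, Finset.mem_singleton, Finset.mem_insert]
  by_cases hx : x = v
  · subst hx; tauto
  · tauto

theorem improve_eq (Q : Finset (Fin I.n)) :
    I.improve Q = Q ∨ (∃ v ∈ Q, I.improve Q = Q.erase v) ∨ ∃ v ∉ Q, I.improve Q = insert v Q := by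
  rcases List.mem_cons.1 (I.best_spec Q (I.moves Q)).1 with h | h
  · exact Or.inl h
  · obtain ⟨v, -, h⟩ := List.mem_map.1 h
    by_cases hv : v ∈ Q
    · rw [I.toggle_of_mem hv] at h
      exact Or.inr (Or.inl ⟨v, hv, h.symm⟩)
    · rw [I.toggle_of_notMem hv] at h
      exact Or.inr (Or.inr ⟨v, hv, h.symm⟩)

theorem score_toggle_le (Q : Finset (Fin I.n)) (v : Fin I.n) :
    I.score (I.toggle Q v) ≤ I.score (I.improve Q) :=
  (I.best_spec Q (I.moves Q)).2 _ (List.mem_cons_of_mem _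
    (List.mem_map_of_mem (List.mem_finRange v)))

theorem improve_of_card_eq {Q : Finset (Fin I.n)} (h : Q.card = I.k) : I.improve Q = Q := by
  have h₁ := I.dist_le_of_score_le ((I.best_spec Q (I.moves Q)).2 Q List.mem_cons_self)
  change I.dist (I.improve Q) ≤ _ at h₁
  rcases I.improve_eq Q with h' | ⟨v, hv, h'⟩ | ⟨v, hv, h'⟩
  · exact h'
  · have h₂ := Finset.card_erase_add_one hv
    rw [h', dist, dist] at h₁
    omega
  · have h₂ := Finset.card_insert_of_notMem hv
    rw [h', dist, dist] at h₁
    omega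

theorem improve_of_card_lt {Q : Finset (Fin I.n)} (h : Q.card < I.k) :
    (I.improve Q).card = Q.card + 1 ∧ Q ⊆ I.improve Q := by
  obtain ⟨w, hw⟩ : ∃ w, w ∉ Q := by
    by_contra hall
    push Not at hall
    have : Q.card = I.n := by rw [Finset.eq_univ_iff_forall.2 hall]; simp
    have := I.k_le
    omega
  -- Adding any outside node already reduces the distance, so the best move must reduce it as well
  -- and can only be an insertion.
  have h₁ := I.dist_le_of_score_le (I.score_toggle_le Q w)
  rw [I.toggle_of_notMem hw, dist, dist, Finset.card_insert_of_notMem hw] at h₁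
  rcases I.improve_eq Q with h' | ⟨v, hv, h'⟩ | ⟨v, hv, h'⟩
  · rw [h'] at h₁
    omega
  · have h₂ := Finset.card_erase_add_one hv
    rw [h'] at h₁
    omega
  · rw [h']
    exact ⟨Finset.card_insert_of_notMem hv, Finset.subset_insert _ _⟩

theorem improve_of_lt_card {Q : Finset (Fin I.n)} (h : I.k < Q.card) :
    (I.improve Q).card + 1 = Q.card ∧ ∀ v ∈ Q, I.value (Q.erase v) ≤ I.value (I.improve Q) := by
  have hcard : (I.improve Q).card + 1 = Q.card := by
    obtain ⟨w, hw⟩ : Q.Nonempty := Finset.card_pos.1 (by omega)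
    have h₁ := I.dist_le_of_score_le (I.score_toggle_le Q w)
    have h₀ := Finset.card_erase_add_one hw
    rw [I.toggle_of_mem hw, dist, dist] at h₁
    rcases I.improve_eq Q with h' | ⟨v, hv, h'⟩ | ⟨v, hv, h'⟩
    · rw [h'] at h₁
      omega
    · rw [h']
      exact Finset.card_erase_add_one hv
    · have h₂ := Finset.card_insert_of_notMem hv
      rw [h'] at h₁
      omega
  refine ⟨hcard, fun v hv => ?_⟩
  have h₁ := I.score_toggle_le Q v
  rw [I.toggle_of_mem hv] at h₁
  refine I.value_le_of_score_le h₁ ?_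
  have h₂ := Finset.card_erase_add_one hv
  rw [dist, dist]
  omega

/-- Double counting: a hyperedge inside `Q` survives the removal of each of the `|Q| - l` nodes not
on it. -/
theorem sum_value_erase (Q : Finset (Fin I.n)) :
    I.value Q * (Q.card - l) ≤ ∑ v ∈ Q, I.value (Q.erase v) := by
  simp only [value_eq_sum]
  rw [Finset.sum_comm, Finset.sum_mul]
  refine Finset.sum_le_sum fun u _ => ?_
  by_cases hu : I.hAt u ⊆ Q
  · have h₁ : (Q \ I.hAt u).card = Q.card - l := by
      rw [Finset.card_sdiff_of_subset hu, I.hAt_card]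
    rw [if_pos hu, one_mul, ← h₁, Finset.card_eq_sum_ones]
    calc ∑ v ∈ Q \ I.hAt u, 1 = ∑ v ∈ Q \ I.hAt u, if I.hAt u ⊆ Q.erase v then 1 else 0 := by
          refine Finset.sum_congr rfl fun v hv => ?_
          rw [if_pos]
          exact Finset.subset_erase.2 ⟨hu, (Finset.mem_sdiff.1 hv).2⟩
      _ ≤ _ := Finset.sum_le_sum_of_subset Finset.sdiff_subset
  · simp [hu]

theorem value_improve {Q : Finset (Fin I.n)} (h : I.k < Q.card) :
    I.value Q * (Q.card - l) ≤ I.value (I.improve Q) * Q.card := by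
  refine (I.sum_value_erase Q).trans ?_
  calc ∑ v ∈ Q, I.value (Q.erase v) ≤ ∑ v ∈ Q, I.value (I.improve Q) :=
        Finset.sum_le_sum (I.improve_of_lt_card h).2
    _ = I.value (I.improve Q) * Q.card := by simp [mul_comm]

theorem dist_iterate (Q : Finset (Fin I.n)) (j : ℕ) :
    I.dist (I.improve^[j] Q) ≤ I.dist Q - j := by
  induction j generalizing Q with
  | zero => simp
  | succ j ih =>
    rw [Function.iterate_succ_apply]
    refine (ih _).trans ?_
    rcases lt_trichotomy Q.card I.k with h | h | h
    · have := (I.improve_of_card_lt h).1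
      rw [dist, dist]
      omega
    · rw [I.improve_of_card_eq h, dist]
      omega
    · have := (I.improve_of_lt_card h).1
      rw [dist, dist]
      omega

theorem card_normalize (Q : Finset (Fin I.n)) : (I.normalize Q).card = I.k := by
  have h₁ := I.dist_iterate Q I.n
  have h₂ := I.dist_le Q
  change I.dist (I.normalize Q) ≤ _ at h₁
  rw [dist] at h₁
  omega

theorem subset_iterate {Q : Finset (Fin I.n)} (h : Q.card ≤ I.k) (j : ℕ) :
    Q ⊆ I.improve^[j] Q := by
  induction j generalizing Q with
  | zero => exact subset_rfl
  | succ j ih =>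
    rw [Function.iterate_succ_apply]
    rcases h.lt_or_eq with h | h
    · obtain ⟨h₁, h₂⟩ := I.improve_of_card_lt h
      exact h₂.trans (ih (by omega))
    · rw [I.improve_of_card_eq h]
      exact ih h.le

/-- Each deletion keeps at least the fraction `(q - l) / q` of the hyperedges, where `q` is the
current size. Going from `|Q|` down to `k`, these fractions telescope to a quotient of falling
factorials. -/
theorem value_iterate {Q : Finset (Fin I.n)} (h : I.k ≤ Q.card) (j : ℕ) (hj : Q.card - I.k ≤ j) :
    I.value Q * I.k.descFactorial l ≤ I.value (I.improve^[j] Q) * Q.card.descFactorial l := by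
  induction j generalizing Q with
  | zero =>
    rw [show I.k = Q.card by omega]
    rfl
  | succ j ih =>
    rw [Function.iterate_succ_apply]
    rcases h.lt_or_eq with h | h
    -- Here `k < l` and the left side vanishes; otherwise `|Q| - l` is positive and may be
    -- cancelled.
    · by_cases hl : Q.card ≤ l
      · rw [Nat.descFactorial_of_lt (by omega : I.k < l)]
        simp
      have h₁ := I.value_improve h
      have h₂ := (I.improve_of_lt_card h).1
      have h₃ := ih (Q := I.improve Q) (by omega) (by omega)
      have h₄ := Nat.succ_descFactorial (I.improve Q).card l
      rw [h₂] at h₄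
      have h₅ : 0 < Q.card - l := by omega
      refine Nat.le_of_mul_le_mul_left ?_ h₅
      calc (Q.card - l) * (I.value Q * I.k.descFactorial l)
          = (I.value Q * (Q.card - l)) * I.k.descFactorial l := by ring
        _ ≤ (I.value (I.improve Q) * Q.card) * I.k.descFactorial l := by gcongr
        _ = Q.card * (I.value (I.improve Q) * I.k.descFactorial l) := by ring
        _ ≤ Q.card * (I.value (I.improve^[j] (I.improve Q)) *
              (I.improve Q).card.descFactorial l) := by gcongr
        _ = I.value (I.improve^[j] (I.improve Q)) *
              (Q.card * (I.improve Q).card.descFactorial l) := by ring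
        _ = I.value (I.improve^[j] (I.improve Q)) *
              ((Q.card - l) * Q.card.descFactorial l) := by rw [h₄]
        _ = _ := by ring
    · rw [I.improve_of_card_eq h.symm]
      exact ih h.le (by omega)

theorem value_normalize {Q : Finset (Fin I.n)} (h : I.k ≤ Q.card) :
    I.value Q * I.k.descFactorial l ≤ I.value (I.normalize Q) * Q.card.descFactorial l := by
  refine I.value_iterate h I.n ?_
  have := Finset.card_le_univ Q
  rw [Fintype.card_fin] at this
  omega

theorem value_normalize_of_card_le {Q : Finset (Fin I.n)} (h : Q.card ≤ I.k) :
    I.value Q ≤ I.value (I.normalize Q) := I.value_mono (I.subset_iterate h I.n)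

theorem mem_smallSets {K : ℕ} {T : Finset (Fin I.n)} (h : T.card ≤ K) : T ∈ I.smallSets K := by
  induction K generalizing T with
  | zero =>
    rw [Finset.card_eq_zero.1 (Nat.le_zero.1 h)]
    simp [smallSets]
  | succ K ih =>
    rw [smallSets, List.mem_flatMap]
    rcases Nat.lt_or_ge K T.card with h' | h'
    · obtain ⟨v, hv⟩ : T.Nonempty := Finset.card_pos.1 (by omega)
      refine ⟨T.erase v, ih ?_, List.mem_cons_of_mem _ (List.mem_map.2 ⟨v, by simp, ?_⟩)⟩
      · have := Finset.card_erase_add_one hv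
        omega
      · rw [I.toggle_of_notMem (by simp), Finset.insert_erase hv]
    · exact ⟨T, ih h', List.mem_cons_self⟩

variable (A : (I : SSVE) → Finset (Fin I.nU)) (K : ℕ)

theorem card_solve : (I.solve A K).card = I.k := by
  rcases List.mem_cons.1 (I.best_spec (I.normalize ∅) ((I.candidates A K).map I.normalize)).1
    with h | h
  · exact (congrArg Finset.card h).trans (I.card_normalize _)
  · obtain ⟨Q, -, h⟩ := List.mem_map.1 h
    exact (congrArg Finset.card h).symm.trans (I.card_normalize _)

theorem value_le_solve {Q : Finset (Fin I.n)} (hQ : Q ∈ I.candidates A K) :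
    I.value (I.normalize Q) ≤ I.value (I.solve A K) := by
  refine I.value_le_of_score_le ((I.best_spec (I.normalize ∅) _).2 _
    (List.mem_cons_of_mem _ (List.mem_map_of_mem hQ))) ?_
  have h := I.card_solve A K
  have h' := I.card_normalize Q
  change I.dist _ = I.dist (I.solve A K)
  rw [dist, dist, h, h']

theorem card_le_value {S : Finset (Fin I.m)} {Q : Finset (Fin I.n)}
    (h : ∀ u ∈ S, I.hAt u ⊆ Q) : S.card ≤ I.value Q := by
  rw [value_eq_sum]
  calc S.card = ∑ u ∈ S, 1 := Finset.card_eq_sum_ones S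
    _ = ∑ u ∈ S, if I.hAt u ⊆ Q then 1 else 0 :=
      Finset.sum_congr rfl fun u hu => (if_pos (h u hu)).symm
    _ ≤ _ := Finset.sum_le_sum_of_subset (Finset.subset_univ _)

theorem card_le_value_nbrs (j : Fin I.m) (S : Finset (Fin I.m)) :
    S.card ≤ I.value ((I.toSSVE j).nbrs S) :=
  I.card_le_value fun u hu _ hv => I.mem_nbrs_toSSVE.2 ⟨u, hu, hv⟩

theorem one_le_value_toSSVE (hl : 1 ≤ l) (j : Fin I.m) (S : Finset (Fin I.m))
    (hS : (I.toSSVE j).Feasible S) : 1 ≤ (I.toSSVE j).value S := by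
  rw [feasible_toSSVE] at hS
  obtain ⟨u, hu⟩ : S.Nonempty := Finset.card_pos.1 (by omega)
  obtain ⟨v, hv⟩ : (I.hAt u).Nonempty := Finset.card_pos.1 (by rw [I.hAt_card]; omega)
  exact Finset.card_pos.2 ⟨v, I.mem_nbrs_toSSVE.2 ⟨u, hu, hv⟩⟩

theorem exists_feasible_toSSVE (T : Finset (Fin I.n)) (j : Fin I.m) (hj : j.1 + 1 = I.value T) :
    ∃ S, (I.toSSVE j).Feasible S ∧ (I.toSSVE j).value S ≤ T.card := by
  let S : Finset (Fin I.m) := Finset.univ.filter fun u => I.hAt u ⊆ T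
  refine ⟨S, (I.feasible_toSSVE j S).2 ?_, Finset.card_le_card ?_⟩
  · rw [hj, value_eq_sum, Finset.card_filter]
  · intro v hv
    obtain ⟨u, hu, hv⟩ := I.mem_nbrs_toSSVE.1 hv
    exact (Finset.mem_filter.1 hu).2 hv

theorem hasApprox (hl : 2 ≤ l) {ρ : ℕ → ℕ → ℕ → ℝ} (hρ : STCut.HasApprox ρ) {σ : ℕ → ℕ → ℝ}
    (hσ : ∀ m n, BoundsRatio ρ 3 (l * m) (m + n) (σ m n)) :
    HasApprox l (fun m n => 2 * σ m n ^ l) := by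
  obtain ⟨A, hA, hA'⟩ := SSVE.exists_algorithm hρ
  -- Brute force up to `2 * l * l` covers exactly the `k` for which `pow_le_two_mul_descFactorial`
  -- is not available.
  refine ⟨fun I => I.solve A (2 * l * l), polyTime_solve hA _, fun I =>
    ⟨I.card_solve A _, fun T hT => ?_⟩⟩
  change (I.value T : ℝ) ≤ 2 * σ I.m I.n ^ l * (I.value (I.solve A (2 * l * l)) : ℝ)
  rcases Nat.eq_zero_or_pos I.m with hm | hm
  · have h₁ := I.value_le T
    have h₂ := I.value_le (I.solve A (2 * l * l))
    rw [hm] at h₁ h₂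
    rw [Nat.le_zero.1 h₁, Nat.le_zero.1 h₂]
    simp
  have hspec : ∀ j : Fin I.m, _ := fun j => (hA' (I.toSSVE j)).2 (σ I.m I.n)
    (by rw [m_toSSVE]; exact Nat.mul_pos (by omega) hm)
    (by rw [m_toSSVE, n_toSSVE]; exact hσ _ _)
  -- Not assumed for `σ`, but forced because every feasible set of hyperedges has a neighbour. It is
  -- needed wherever the algorithm is exact and the factor `2 * σ ^ l` has to be at least 1.
  have hσ1 : 1 ≤ σ I.m I.n :=
    (hspec ⟨0, hm⟩).2.2 fun S hS => I.one_le_value_toSSVE (by omega) _ S hS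
  have hpow : 1 ≤ σ I.m I.n ^ l := one_le_pow₀ hσ1
  have of_le : I.value T ≤ I.value (I.solve A (2 * l * l)) →
      (I.value T : ℝ) ≤ 2 * σ I.m I.n ^ l * (I.value (I.solve A (2 * l * l)) : ℝ) := by
    intro h
    have h' : (I.value T : ℝ) ≤ I.value (I.solve A (2 * l * l)) := by exact_mod_cast h
    exact h'.trans (le_mul_of_one_le_left (by positivity) (by linarith))
  rcases Nat.lt_or_ge I.k (2 * l * l) with hk | hk
  · refine of_le ((I.value_normalize_of_card_le hT.le).trans (I.value_le_solve A _ ?_))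
    exact List.mem_append_right _ (I.mem_smallSets (by omega))
  rcases Nat.eq_zero_or_pos (I.value T) with h₀ | h₀
  · exact of_le (by omega)
  have hTm := I.value_le T
  -- The round in which the number of hyperedges asked for is that of `T`; the hyperedges inside `T`
  -- are then a feasible set with at most `k` neighbours.
  let j : Fin I.m := ⟨I.value T - 1, by omega⟩
  have hj : j.1 + 1 = I.value T := by simp only [j]; omega
  obtain ⟨S, hS, hSk⟩ := I.exists_feasible_toSSVE T j hj
  have hq := (hspec j).2.1 S hS
  let Q : Finset (Fin I.n) := I.covered A j
  have hQ : I.value T ≤ I.value Q := by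
    rw [← hj]
    exact ((I.feasible_toSSVE j _).1 (hA' (I.toSSVE j)).1).trans (I.card_le_value_nbrs j _)
  have hQs : I.value (I.normalize Q) ≤ I.value (I.solve A (2 * l * l)) :=
    I.value_le_solve A _ (List.mem_append_left _ (List.mem_map_of_mem (List.mem_finRange j)))
  rcases Nat.lt_or_ge I.k Q.card with hkq | hkq
  · have hq' : (Q.card : ℝ) ≤ σ I.m I.n * I.k + 1 / ((I.m + I.n : ℕ) : ℝ) := by
      refine hq.trans ?_
      rw [n_toSSVE]
      gcongr
      rw [← hT]
      exact hSk
    have hln : l ≤ I.m + I.n := by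
      have := Finset.card_le_univ (I.hAt ⟨0, hm⟩)
      rw [hAt_card, Fintype.card_fin] at this
      omega
    have h₁ := descFactorial_le_pow_real hl hln (by omega) hq'
    have h₂ := pow_le_two_mul_descFactorial hk
    have h₃ := I.value_normalize hkq.le
    have hkpos : 0 < I.k := lt_of_lt_of_le (by positivity) hk
    have hkpos' : (0 : ℝ) < (I.k : ℝ) ^ l := by positivity
    have h₂' : (I.k : ℝ) ^ l ≤ 2 * I.k.descFactorial l := by exact_mod_cast h₂
    have h₃' : (I.value Q : ℝ) * I.k.descFactorial l ≤
        I.value (I.normalize Q) * Q.card.descFactorial l := by exact_mod_cast h₃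
    have hQ' : (I.value T : ℝ) ≤ I.value Q := by exact_mod_cast hQ
    have hQs' : (I.value (I.normalize Q) : ℝ) ≤ I.value (I.solve A (2 * l * l)) := by
      exact_mod_cast hQs
    refine le_of_mul_le_mul_right ?_ hkpos'
    calc (I.value T : ℝ) * (I.k : ℝ) ^ l ≤ I.value Q * (2 * I.k.descFactorial l) := by gcongr
      _ = 2 * (I.value Q * I.k.descFactorial l) := by ring
      _ ≤ 2 * (I.value (I.normalize Q) * Q.card.descFactorial l) := by gcongr
      _ ≤ 2 * (I.value (I.solve A (2 * l * l)) * (σ I.m I.n * I.k) ^ l) := by gcongr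
      _ = _ := by rw [mul_pow]; ring
  · exact of_le (hQ.trans ((I.value_normalize_of_card_le hkq).trans hQs))

end DkS

end KRoute

theorem theorem4p2 :
    ∃ c : ℕ,
      -- the reduction: instance map `f`, solution map `g`, scaling factor `B`
      (∃ (f : SSVE → STCut) (g : (I : SSVE) → Finset (Fin (f I).m) → Finset (Fin I.nU))
          (B : SSVE → ℕ),
        PolyTime SSVE.enc (fun I => (f I).enc) ∧
        PolyTime (fun x : (I : SSVE) × Finset (Fin (f I).m) => Data.pair x.1.enc (encSet x.2))
          (fun x => encSet (g x.1 x.2)) ∧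
        ∀ I : SSVE,
          (1 ≤ I.n → (f I).n ≤ c * I.n ^ 3) ∧
          (f I).m ≤ c * (I.m * I.n ^ 2 + I.n ^ 5) ∧
          (1 ≤ I.m → (f I).k ≤ c * (I.m * I.n ^ 2)) ∧
          0 < B I ∧
          (∀ S, I.Feasible S →
            ∃ F, (f I).Feasible F ∧ (f I).cost F ≤ (I.value S : ℚ≥0) * (B I : ℚ≥0)) ∧
          (∀ F, (f I).Feasible F →
            I.Feasible (g I F) ∧
            (∀ C : ℕ, (f I).cost F ≤ (C : ℚ≥0) * (B I : ℚ≥0) → I.value (g I F) ≤ C) ∧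
            (I.value (g I F) : ℝ) ≤ ((f I).cost F : ℝ) / (B I : ℝ) + 1 / (I.n : ℝ))) ∧
      -- transfer of approximation ratios to small-set vertex expansion
      (∀ ρ : ℕ → ℕ → ℕ → ℝ, STCut.HasApprox ρ →
        (∀ σ : ℕ → ℕ → ℕ, (∀ m n, BoundsRatio ρ c m n (σ m n : ℝ)) →
          SSVE.HasApprox (fun m n => (σ m n : ℝ))) ∧
        (∀ σ : ℕ → ℕ → ℝ, (∀ m n, BoundsRatio ρ c m n (σ m n)) →
          SSVE.HasApprox (fun m n => σ m n + 1 / (n : ℝ)))) ∧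
      -- transfer to densest `k`-subgraph on `l`-uniform hypergraphs
      (∀ l : ℕ, 2 ≤ l → ∀ ρ : ℕ → ℕ → ℕ → ℝ, STCut.HasApprox ρ →
        ∀ σ : ℕ → ℕ → ℝ, (∀ m n, BoundsRatio ρ c (l * m) (m + n) (σ m n)) →
          DkS.HasApprox l (fun m n => 2 * σ m n ^ l)) := by
  -- The constant 3 comes from `n + 2 ≤ 3 * n ^ 3`, from the three expensive edges per edge of the
  -- bipartite graph, and from the three terms of `k`.
  refine ⟨3, ⟨SSVE.toSTCut, SSVE.fromCut, SSVE.mult, SSVE.polyTime_toSTCut,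
    SSVE.polyTime_fromCut, fun I => ⟨I.n_toSTCut_le, I.m_toSTCut_le, I.k_toSTCut_le,
      Nat.succ_pos _, fun S hS => ⟨I.toCut S, I.feasible_toCut hS, (I.cost_toCut S).le⟩,
      fun F hF => ⟨I.feasible_fromCut hF, fun C hC => SSVE.value_fromCut_le_nat hC,
        I.value_fromCut_le_real F⟩⟩⟩,
    fun ρ hρ => ⟨fun σ hσ => SSVE.hasApprox_nat hρ hσ, fun σ hσ => SSVE.hasApprox_real hρ hσ⟩,
    fun l hl ρ hρ σ hσ => DkS.hasApprox hl hρ hσ⟩
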